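/- Let $V$ be a finite set and let $(Y_k)_{k\in V}$ be real random variables on a probability space. Suppose that a multigraph $G$ on the vertex set $V$ (parallel edges and loops are allowed) is a dependency graph of $(Y_k)_{k\in V}$, that is: whenever $V_1,V_2\subset V$ are disjoint and no edge of $G$ has one vertex in $V_1$ and the other in $V_2$, the families $(Y_k)_{k\in V_1}$ and $(Y_k)_{k\in V_2}$ are independent. Let $D\in\mathbb Z_{\ge 0}$ be the maximal degree of $G$, where the degree of a vertex is the number of edges it belongs to. Let $(c_k)_{k\in V}$ be arbitrary real numbers and let $L\in(0,\infty)$ be such that $\max_{k\in V}\|Y_k-c_k\|_\infty\le L$. Put $$S=\sum_{k\in V}Y_k,\qquad v=\sqrt{\operatorname{Var}S},\qquad \mathcal A_3=\sum_{k\in V}\mathbb E\big[|Y_k-c_k|^3\big],$$ and assume that $v>0$; put $W=(S-\mathbb E[S])/v$. Then the Kolmogorov distance between $W$ and the standard normal law satisfies $$\sup_{t\in\mathbb R}\big|\mathbb P(W\le t)-\mathcal N(0,1)\big((-\infty,t]\big)\big|\;\le\;\max\left\{68.5\,\frac{(D+1)^2\mathcal A_3}{v^3}\,,\;22.88\,\frac{L(D+1)}{v}\right\}.$$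 -/

import Mathlib

open MeasureTheory ProbabilityTheory
open scoped ENNReal

namespace DepGraph

/-- The maximal degree of a multigraph, the degree of a vertex being the number of edges it
belongs to (parallel edges are counted separately, a loop is counted once). -/
noncomputable def maxDegree {V E : Type*} (G : Graph V E) : ℕ∞ :=
  ⨆ k : V, (G.incidenceSet k).encard

/-- The multigraph `G`, with vertex set the whole index type `V`, is a dependency graph of the
family `(Y k)_{k ∈ V}`: whenever `V₁` and `V₂` are disjoint sets of vertices and no edge has one
vertex in `V₁` and the other in `V₂`, the families `(Y k)_{k ∈ V₁}` and `(Y k)_{k ∈ V₂}` are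
independent. -/
def IsDependencyGraph {V E Ω : Type*} [MeasurableSpace Ω]
    (G : Graph V E) (Y : V → Ω → ℝ) (P : Measure Ω) : Prop :=
  G.vertexSet = Set.univ ∧
    ∀ V₁ V₂ : Set V, Disjoint V₁ V₂ → (∀ i ∈ V₁, ∀ j ∈ V₂, ¬ G.Adj i j) →
      IndepFun (fun ω (k : V₁) => Y k ω) (fun ω (k : V₂) => Y k ω) P

section Sums

variable {V Ω : Type*} [Fintype V] [MeasurableSpace Ω]

/-- The sum `S = ∑ k, Y k`. -/
def sumS (Y : V → Ω → ℝ) : Ω → ℝ := fun ω => ∑ k, Y k ω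

/-- The standard deviation `v = √Var S`. -/
noncomputable def stdDev (Y : V → Ω → ℝ) (P : Measure Ω) : ℝ :=
  √(variance (sumS Y) P)

/-- The normalized sum `W = (S - E S) / v`. -/
noncomputable def normalizedSum (Y : V → Ω → ℝ) (P : Measure Ω) : Ω → ℝ :=
  fun ω => (sumS Y ω - ∫ ω', sumS Y ω' ∂P) / stdDev Y P

/-- `A_δ = ∑ k, E |Y k - c k| ^ δ`. -/
noncomputable def absMoment (Y : V → Ω → ℝ) (c : V → ℝ) (P : Measure Ω) (δ : ℝ) : ℝ :=
  ∑ k, ∫ ω, |Y k ω - c k| ^ δ ∂P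

end Sums

/-- The Kolmogorov distance `sup_t |μ (-∞, t] - ν (-∞, t]|` between two probability measures on
the real line (the supremum is over a set bounded by `1`). -/
noncomputable def kolmogorovDist (μ ν : Measure ℝ) : ℝ :=
  ⨆ t : ℝ, |μ.real (Set.Iic t) - ν.real (Set.Iic t)|

end DepGraph

namespace DepGraph

open Set Filter Topology

/-! ### The standard normal density -/

local notation "φ" => gaussianPDFReal 0 1

/-! The proof is Stein's method with a self-bounding concentration step. Centre and normalise the `Y
k` to `X k` with sum `W`, and let `η k` be the sum of `X` over the closed neighbourhood of `k`,
which has at most `m = D + 1` elements. For a ramp `h` of width `ε`, let `f` solve Stein's equation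
(`exists_stein_solution`). Since `X k` is centred and independent of `W - η k`, `E[W f(W)] = ∑ E[X k
(f(W) - f(W - η k))]`, so `E h(W) - ∫ h dN(0,1)` equals `E[f'(W) (1 - ∑ X k η k)]` plus Taylor
remainders.

As `|f'| ≤ 1` and `∑ X k η k` has mean `1`, the first term is at most the standard deviation of that
sum, which fourth moments control (`variance_sum_mul_sum_nbhd_le`). The remainders are quadratic in
`η k`, with a weight in `W` that is of size `1/ε` only near the slope of the ramp (`stein_taylor`).
Decoupling (`sum_integral_mul_comp_le`) leaves third moments times `P(W ∈ I)/ε` for a short interval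
`I`, and this probability is at most its Gaussian analogue plus twice the Kolmogorov distance `Δ`.
For `ε` proportional to the third-moment bound `R`, `Δ` reappears with coefficient `1/3` and can be
absorbed (`IsLocallyDependent.kolmogorovDist_le`). -/

lemma stdGaussianPDF_eq (x : ℝ) : φ x = (√(2 * Real.pi))⁻¹ * Real.exp (-x ^ 2 / 2) := by
  simp [gaussianPDFReal_def]

lemma stdGaussianPDF_pos (x : ℝ) : 0 < φ x := gaussianPDFReal_pos 0 1 x one_ne_zero

lemma stdGaussianPDF_neg (x : ℝ) : φ (-x) = φ x := by simp [stdGaussianPDF_eq]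

lemma hasDerivAt_stdGaussianPDF (x : ℝ) : HasDerivAt φ (-x * φ x) x := by
  have h1 : HasDerivAt (fun x : ℝ => -x ^ 2 / 2) (-x) x := by
    have := ((hasDerivAt_pow 2 x).neg).div_const 2
    exact this.congr_deriv (by simp; ring)
  have h2 := (h1.exp).const_mul (√(2 * Real.pi))⁻¹
  have h3 : φ = fun x => (√(2 * Real.pi))⁻¹ * Real.exp (-x ^ 2 / 2) :=
    funext stdGaussianPDF_eq
  rw [h3]
  exact h2.congr_deriv (by ring)

lemma continuous_stdGaussianPDF : Continuous (φ) :=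
  continuous_iff_continuousAt.2 fun x => (hasDerivAt_stdGaussianPDF x).continuousAt

/-- Here `0.4` becomes the Lipschitz constant of the normal distribution function, and half of
`2.52` the bound `1.26` on Stein solutions. -/
lemma stdGaussianPDF_zero_bounds : 1 / 2.52 ≤ φ 0 ∧ φ 0 ≤ 0.4 := by
  have h0 : φ 0 = (√(2 * Real.pi))⁻¹ := by simp [stdGaussianPDF_eq]
  have h1 : √(2 * Real.pi) ≤ 2.52 := by
    rw [Real.sqrt_le_left (by norm_num)]
    nlinarith [Real.pi_lt_d2]
  have h2 : 2.5 ≤ √(2 * Real.pi) := by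
    apply Real.le_sqrt_of_sq_le
    nlinarith [Real.pi_gt_d2]
  rw [h0]
  constructor
  · rw [one_div]
    exact inv_anti₀ (by linarith) h1
  · calc (√(2 * Real.pi))⁻¹ ≤ (2.5 : ℝ)⁻¹ := inv_anti₀ (by norm_num) h2
      _ = 0.4 := by norm_num

lemma stdGaussianPDF_le (x : ℝ) : φ x ≤ 0.4 := by
  refine le_trans ?_ stdGaussianPDF_zero_bounds.2
  rw [stdGaussianPDF_eq, stdGaussianPDF_eq]
  gcongr ?_ * Real.exp (?_ / 2)
  nlinarith [sq_nonneg x]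

lemma integral_Iic_neg_stdGaussianPDF (w : ℝ) : ∫ x in Iic (-w), φ x = ∫ x in Ioi w, φ x := by
  rw [← integral_comp_neg_Ioi]
  simp [stdGaussianPDF_neg]

lemma integral_Iic_add_integral_Ioi_stdGaussianPDF (w : ℝ) :
    (∫ x in Iic w, φ x) + ∫ x in Ioi w, φ x = 1 := by
  rw [← integral_gaussianPDFReal_eq_one 0 (one_ne_zero (α := NNReal))]
  exact intervalIntegral.integral_Iic_add_Ioi
    (integrable_gaussianPDFReal 0 1).integrableOn (integrable_gaussianPDFReal 0 1).integrableOn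

/-- Replace the factor `w` by `x ≥ w` under the integral: `x φ x` has the primitive `-φ`. -/
lemma mul_integral_Ioi_stdGaussianPDF_le {w : ℝ} (hw : 0 ≤ w) :
    w * ∫ x in Ioi w, φ x ≤ φ w := by
  have hφ := (integrable_gaussianPDFReal 0 1).integrableOn (s := Ioi w)
  have hlim : Tendsto φ atTop (𝓝 0) := by
    have h1 : Tendsto (fun x : ℝ => Real.exp (-x ^ 2 / 2)) atTop (𝓝 0) := by
      refine Real.tendsto_exp_atBot.comp ?_
      have : Tendsto (fun x : ℝ => x ^ 2 / 2) atTop atTop :=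
        (tendsto_pow_atTop two_ne_zero).atTop_div_const two_pos
      refine (tendsto_neg_atTop_atBot.comp this).congr fun x => ?_
      simp [neg_div]
    have h2 := h1.const_mul (√(2 * Real.pi))⁻¹
    rw [mul_zero] at h2
    exact h2.congr fun x => (stdGaussianPDF_eq x).symm
  have hd : ∀ x ∈ Ioi w, HasDerivAt (fun x => -φ x) (x * φ x) x := fun x _ =>
    (hasDerivAt_stdGaussianPDF x).neg.congr_deriv (by ring)
  have hl : Tendsto (fun x => -φ x) atTop (𝓝 0) := by simpa using hlim.neg
  have hc : ContinuousWithinAt (fun x => -φ x) (Ici w) w :=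
    continuous_stdGaussianPDF.neg.continuousWithinAt
  have hpos : ∀ x ∈ Ioi w, 0 ≤ x * φ x := fun x hx =>
    mul_nonneg (hw.trans (le_of_lt hx)) (stdGaussianPDF_pos x).le
  have hint := integrableOn_Ioi_deriv_of_nonneg hc hd hpos hl
  have heq := integral_Ioi_of_hasDerivAt_of_nonneg hc hd hpos hl
  rw [← integral_const_mul]
  calc ∫ x in Ioi w, w * φ x ≤ ∫ x in Ioi w, x * φ x := by
        refine setIntegral_mono_on (hφ.const_mul w) hint measurableSet_Ioi fun x hx => ?_
        exact mul_le_mul_of_nonneg_right (le_of_lt hx) (stdGaussianPDF_pos x).le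
    _ = φ w := by rw [heq]; ring

/-- For `x ≥ w ≥ 0` one has `x² ≥ w² + (x - w)²`, hence `φ x * φ 0 ≤ φ w * φ (x - w)`; the shifted
half-line has mass `1/2`. -/
lemma integral_Ioi_stdGaussianPDF_le {w : ℝ} (hw : 0 ≤ w) :
    ∫ x in Ioi w, φ x ≤ 1.26 * φ w := by
  have hφ := integrable_gaussianPDFReal 0 1
  have h0 := stdGaussianPDF_zero_bounds.1
  have hhalf : ∫ x in Ioi (0 : ℝ), φ x = 1 / 2 := by
    have h1 := integral_Iic_add_integral_Ioi_stdGaussianPDF 0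
    have h2 := integral_Iic_neg_stdGaussianPDF 0
    rw [neg_zero] at h2
    linarith
  have hshift : ∫ x in Ioi w, φ (x - w) = 1 / 2 := by
    rw [← hhalf, ← integral_indicator measurableSet_Ioi, ← integral_indicator measurableSet_Ioi,
      ← integral_sub_right_eq_self (fun x => indicator (Ioi (0 : ℝ)) φ x) w]
    congr 1
    ext x
    simp [indicator, sub_pos]
  have hle : ∀ x ∈ Ioi w, φ x ≤ 2.52 * φ w * φ (x - w) := fun x hx => by
    have h3 : φ x * φ 0 ≤ φ w * φ (x - w) := by
      simp only [stdGaussianPDF_eq]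
      rw [mul_mul_mul_comm, mul_mul_mul_comm _ (Real.exp (-w ^ 2 / 2)), ← Real.exp_add, ← Real.exp_add]
      have : w < x := hx
      refine mul_le_mul_of_nonneg_left (Real.exp_le_exp.2 ?_) (by positivity)
      nlinarith [mul_nonneg hw (sub_pos.2 this).le]
    have h4 := stdGaussianPDF_pos x
    have h5 : φ x * (1 / 2.52) ≤ φ x * φ 0 := by gcongr
    norm_num at h5 ⊢
    linarith
  calc ∫ x in Ioi w, φ x ≤ ∫ x in Ioi w, 2.52 * φ w * φ (x - w) :=
        setIntegral_mono_on hφ.integrableOn ((hφ.comp_sub_right w).const_mul _).integrableOn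
          measurableSet_Ioi hle
    _ = 1.26 * φ w := by rw [integral_const_mul, hshift]; ring

lemma stdGaussian_real_Iic (t : ℝ) : (gaussianReal 0 1).real (Iic t) = ∫ x in Iic t, φ x := by
  rw [measureReal_def, gaussianReal_apply_eq_integral 0 one_ne_zero, ENNReal.toReal_ofReal]
  exact integral_nonneg fun x => (stdGaussianPDF_pos x).le

lemma stdGaussian_real_Iic_sub_le {a b : ℝ} (hab : a ≤ b) :
    (gaussianReal 0 1).real (Iic b) - (gaussianReal 0 1).real (Iic a) ≤ 0.4 * (b - a) := by
  have hφ := integrable_gaussianPDFReal 0 1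
  rw [stdGaussian_real_Iic, stdGaussian_real_Iic,
    intervalIntegral.integral_Iic_sub_Iic hφ.integrableOn hφ.integrableOn]
  have := intervalIntegral.integral_mono_on hab hφ.intervalIntegrable
    (intervalIntegrable_const (c := (0.4 : ℝ)) (μ := volume)) fun x _ => stdGaussianPDF_le x
  rw [intervalIntegral.integral_const, smul_eq_mul] at this
  linarith

/-! ### The solution of Stein's equation -/

/-- The arithmetic behind `|f'| ≤ 1`: `A`, `B` are the integrals of `h φ` to the two sides of a
point, `a`, `b` those of `φ`, and `p` is the density there. With `r = s * b / p ≤ 1`, the expression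
is `h - (A + B) * (1 - r) - s * B / p`, where `s * B / p` lies in `[0, r]`. -/
lemma stein_deriv_bounds {s A B a b p h : ℝ} (hs : 0 ≤ s) (hp : 0 < p) (hA : 0 ≤ A) (hB : 0 ≤ B)
    (hAa : A ≤ a) (hBb : B ≤ b) (hab : a + b = 1) (hsb : s * b ≤ p) (h0 : 0 ≤ h) (h1 : h ≤ 1) :
    |s * (A * b - B * a) / p + h - (A + B)| ≤ 1 := by
  have ha : a = 1 - b := by linarith
  subst ha
  have hr : s * b / p ≤ 1 := (div_le_one hp).2 hsb
  have hr' : s * B / p ≤ s * b / p := by gcongr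
  have hr0 : 0 ≤ s * B / p := by positivity
  have e : s * (A * b - B * (1 - b)) / p = (A + B) * (s * b / p) - s * B / p := by
    field_simp
    ring
  rw [e, abs_le]
  constructor
  · nlinarith [mul_nonneg (sub_nonneg.2 hr) (show 0 ≤ 1 - (A + B) by linarith)]
  · nlinarith [mul_nonneg (sub_nonneg.2 hr) (add_nonneg hA hB)]

/-- Stein's equation `f' w - w f w = h w - ∫ h dN(0,1)` for a continuous function `h` with values in
`[0, 1]` has a solution that is bounded by `1.26` and whose derivative is bounded by `1`. -/
lemma exists_stein_solution {h : ℝ → ℝ} (hc : Continuous h) (h0 : ∀ x, 0 ≤ h x)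
    (h1 : ∀ x, h x ≤ 1) :
    ∃ f : ℝ → ℝ, ∀ w, HasDerivAt f (w * f w + h w - ∫ x, h x ∂gaussianReal 0 1) w ∧
      |f w| ≤ 1.26 ∧ |w * f w + h w - ∫ x, h x ∂gaussianReal 0 1| ≤ 1 := by
  have hφ := integrable_gaussianPDFReal 0 1
  have hhφ : Integrable (fun x => h x * φ x) :=
    hφ.bdd_mul (c := 1) hc.aestronglyMeasurable
      (Eventually.of_forall fun x => by rw [Real.norm_eq_abs, abs_le]; constructor <;> linarith [h0 x, h1 x])
  have hN : ∫ x, h x ∂gaussianReal 0 1 = ∫ x, h x * φ x := by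
    rw [integral_gaussianReal_eq_integral_smul one_ne_zero]
    simp [mul_comm]
  rw [hN]
  set N := ∫ x, h x * φ x
  set A := fun w : ℝ => ∫ x in Iic w, h x * φ x with hAdef
  set B := fun w : ℝ => ∫ x in Ioi w, h x * φ x with hBdef
  set a := fun w : ℝ => ∫ x in Iic w, φ x with hadef
  set b := fun w : ℝ => ∫ x in Ioi w, φ x with hbdef
  have hAB : ∀ w, A w + B w = N := fun w =>
    intervalIntegral.integral_Iic_add_Ioi hhφ.integrableOn hhφ.integrableOn
  have hab : ∀ w, a w + b w = 1 := integral_Iic_add_integral_Ioi_stdGaussianPDF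
  have hnn : ∀ x, 0 ≤ h x * φ x := fun x => mul_nonneg (h0 x) (stdGaussianPDF_pos x).le
  have hle : ∀ x, h x * φ x ≤ φ x := fun x =>
    mul_le_of_le_one_left (stdGaussianPDF_pos x).le (h1 x)
  have hA0 : ∀ w, 0 ≤ A w := fun w => integral_nonneg hnn
  have hB0 : ∀ w, 0 ≤ B w := fun w => integral_nonneg hnn
  have hAa : ∀ w, A w ≤ a w := fun w => integral_mono hhφ.integrableOn hφ.integrableOn hle
  have hBb : ∀ w, B w ≤ b w := fun w => integral_mono hhφ.integrableOn hφ.integrableOn hle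
  have hbneg : ∀ w, a w = b (-w) := fun w => by
    have := integral_Iic_neg_stdGaussianPDF (-w)
    rwa [neg_neg] at this
  have hprim : ∀ (g : ℝ → ℝ), Continuous g → Integrable g → ∀ w,
      HasDerivAt (fun w => ∫ x in Iic w, g x) (g w) w := fun g hg hgi w => by
    have e : (fun w => ∫ x in Iic w, g x) = fun w => (∫ x in Iic 0, g x) + ∫ x in (0 : ℝ)..w, g x := by
      ext w
      rw [← intervalIntegral.integral_Iic_sub_Iic hgi.integrableOn hgi.integrableOn]
      ring
    rw [e]
    exact (intervalIntegral.integral_hasDerivAt_right (hg.intervalIntegrable _ _)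
      (hg.stronglyMeasurableAtFilter _ _) hg.continuousAt).const_add _
  -- This is the usual solution `(A - N a) / φ`, rewritten through `A + B = N` and `a + b = 1` so
  -- that reflection merely swaps the two sides.
  refine ⟨fun w => (A w * b w - B w * a w) / φ w, fun w => ?_⟩
  have hp := stdGaussianPDF_pos w
  refine ⟨?_, ?_, ?_⟩
  · have e : (fun w => (A w * b w - B w * a w) / φ w) = fun w => (A w - N * a w) / φ w := by
      ext w
      rw [← hAB w, show b w = 1 - a w by linarith [hab w]]
      ring
    have hd := ((hprim _ (hc.mul continuous_stdGaussianPDF) hhφ w).sub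
      ((hprim _ continuous_stdGaussianPDF hφ w).const_mul N)).div
        (hasDerivAt_stdGaussianPDF w) hp.ne'
    rw [e]
    refine hd.congr_deriv (Eq.symm ?_)
    change w * ((A w - N * a w) / φ w) + h w - N = ((h w * φ w - N * φ w) * φ w -
      (A w - N * a w) * (-w * φ w)) / φ w ^ 2
    field_simp
    ring
  · have hb : |A w * b w - B w * a w| ≤ a w * b w := by
      have h2 := mul_le_mul_of_nonneg_right (hAa w) ((hB0 w).trans (hBb w))
      have h3 := mul_le_mul_of_nonneg_right (hBb w) ((hA0 w).trans (hAa w))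
      have h4 := mul_nonneg (hA0 w) ((hB0 w).trans (hBb w))
      have h5 := mul_nonneg (hB0 w) ((hA0 w).trans (hAa w))
      rw [abs_le]
      constructor <;> linarith
    rw [abs_div, abs_of_pos hp, div_le_iff₀ hp]
    refine hb.trans ?_
    have ha0 := (hA0 w).trans (hAa w)
    have hb0 := (hB0 w).trans (hBb w)
    rcases le_total 0 w with hw | hw
    · have := integral_Ioi_stdGaussianPDF_le hw
      nlinarith [hab w]
    · have := integral_Ioi_stdGaussianPDF_le (neg_nonneg.2 hw)
      rw [stdGaussianPDF_neg] at this
      have h2 := hbneg w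
      simp only [hbdef] at h2
      rw [← h2] at this
      nlinarith [hab w]
  · change |w * ((A w * b w - B w * a w) / φ w) + h w - N| ≤ 1
    rcases le_total 0 w with hw | hw
    · have := stein_deriv_bounds hw hp (hA0 w) (hB0 w) (hAa w) (hBb w) (hab w)
        (mul_integral_Ioi_stdGaussianPDF_le hw) (h0 w) (h1 w)
      rwa [hAB, mul_div_assoc] at this
    · have h2 := mul_integral_Ioi_stdGaussianPDF_le (neg_nonneg.2 hw)
      rw [stdGaussianPDF_neg] at h2
      have h3 := hbneg w
      simp only [hbdef] at h3
      rw [← h3] at h2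
      -- Swapping the sides changes the sign of the numerator, which compensates for using `-w` in
      -- place of `w`.
      have := stein_deriv_bounds (neg_nonneg.2 hw) hp (hB0 w) (hA0 w) (hBb w) (hAa w)
        (by rw [add_comm]; exact hab w) h2 (h0 w) (h1 w)
      rw [add_comm (B w), hAB] at this
      convert this using 2
      ring

/-! ### Ramp functions and the Taylor remainder -/

/-- Second-order Taylor bound from a linear bound on the first derivative. -/
lemma abs_le_of_abs_deriv_le_mul_abs {g g' : ℝ → ℝ} {C r : ℝ} (hg : ∀ s, HasDerivAt g (g' s) s)
    (h0 : g 0 = 0) (hb : ∀ s, |s| ≤ |r| → |g' s| ≤ C * |s|) : |g r| ≤ C * r ^ 2 / 2 := by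
  have key : ∀ (g g' : ℝ → ℝ) (r : ℝ), 0 ≤ r → (∀ s, HasDerivAt g (g' s) s) → g 0 = 0 →
      (∀ s, |s| ≤ |r| → |g' s| ≤ C * |s|) → |g r| ≤ C * r ^ 2 / 2 := by
    intro g g' r hr hg h0 hb
    have := image_norm_le_of_norm_deriv_right_le_deriv_boundary (f := g) (f' := g') (a := 0)
      (b := r) (B := fun s => C * s ^ 2 / 2) (B' := fun s => C * s)
      (fun s _ => (hg s).continuousAt.continuousWithinAt)
      (fun s _ => (hg s).hasDerivWithinAt) (by simp [h0])
      (fun s => (((hasDerivAt_pow 2 s).const_mul C).div_const 2).congr_deriv (by simp; ring))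
      (fun s hs => by
        have := hb s (by rw [abs_of_nonneg hs.1, abs_of_nonneg hr]; exact hs.2.le)
        rwa [abs_of_nonneg hs.1] at this)
    exact this (right_mem_Icc.2 hr)
  rcases le_total 0 r with hr | hr
  · exact key g g' r hr hg h0 hb
  · have := key (fun s => g (-s)) (fun s => -g' (-s)) (-r) (neg_nonneg.2 hr)
      (fun s => by
        have := (hg (-s)).comp s (hasDerivAt_neg s)
        simpa [Function.comp_def] using this) (by simpa using h0)
      (fun s hs => by
        rw [abs_neg]
        simpa using hb (-s) (by simpa using hs))
    simpa using this

/-- The continuous function that is `1` on `(-∞, t]`, `0` on `[t + ε, ∞)` and affine in between. -/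
noncomputable def ramp (t ε x : ℝ) : ℝ := max 0 (min 1 (1 - (x - t) / ε))

lemma ramp_nonneg (t ε x : ℝ) : 0 ≤ ramp t ε x := le_max_left _ _

lemma ramp_le_one (t ε x : ℝ) : ramp t ε x ≤ 1 := max_le zero_le_one (min_le_left _ _)

lemma continuous_ramp (t ε : ℝ) : Continuous (ramp t ε) := by
  unfold ramp
  fun_prop

lemma ramp_of_le {t ε x : ℝ} (hε : 0 < ε) (hx : x ≤ t) : ramp t ε x = 1 := by
  have : (x - t) / ε ≤ 0 := div_nonpos_of_nonpos_of_nonneg (by linarith) hε.le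
  rw [ramp, min_eq_left (by linarith), max_eq_right zero_le_one]

lemma ramp_of_ge {t ε x : ℝ} (hε : 0 < ε) (hx : t + ε ≤ x) : ramp t ε x = 0 := by
  have : 1 ≤ (x - t) / ε := by rw [le_div_iff₀ hε]; linarith
  rw [ramp, max_eq_left]
  exact (min_le_right _ _).trans (by linarith)

lemma abs_ramp_sub_le {t ε : ℝ} (hε : 0 < ε) (x y : ℝ) :
    |ramp t ε x - ramp t ε y| ≤ |x - y| / ε := by
  have h1 : |ramp t ε x - ramp t ε y| ≤ |min 1 (1 - (x - t) / ε) - min 1 (1 - (y - t) / ε)| := by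
    unfold ramp
    simpa using abs_max_sub_max_le_max (0 : ℝ) (min 1 (1 - (x - t) / ε)) 0
      (min 1 (1 - (y - t) / ε))
  refine h1.trans ?_
  have h2 := abs_min_sub_min_le_max 1 (1 - (x - t) / ε) 1 (1 - (y - t) / ε)
  refine h2.trans (max_le (by simp; positivity) ?_)
  rw [show 1 - (x - t) / ε - (1 - (y - t) / ε) = -((x - y) / ε) by ring, abs_neg, abs_div,
    abs_of_pos hε]

/-- The ramp is constant off its slope, so a shift by at most `β` matters only within `β` of it.
This localisation is what later makes the factor `1/ε` affordable. -/
lemma abs_ramp_sub_le_indicator {t ε β w s : ℝ} (hε : 0 < ε) (hs : |s| ≤ β) :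
    |ramp t ε w - ramp t ε (w - s)| ≤
      (Ioc (t - β) (t + ε + β)).indicator (fun _ => 1 / ε) w * |s| := by
  have hs' := abs_le.1 hs
  by_cases hw : w ∈ Ioc (t - β) (t + ε + β)
  · rw [indicator_of_mem hw]
    refine (abs_ramp_sub_le hε _ _).trans (le_of_eq ?_)
    rw [sub_sub_cancel]
    ring
  · rw [indicator_of_notMem hw, zero_mul]
    rw [mem_Ioc, not_and_or, not_lt, not_le] at hw
    rcases hw with hw | hw
    · rw [ramp_of_le hε (by linarith), ramp_of_le hε (by linarith)]
      simp
    · rw [ramp_of_ge hε (by linarith), ramp_of_ge hε (by linarith)]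
      simp

/-- First-order Taylor bound for the solution of Stein's equation for a ramp function. -/
lemma stein_taylor {t ε β N : ℝ} {f : ℝ → ℝ} (hε : 0 < ε)
    (hf : ∀ w, HasDerivAt f (w * f w + ramp t ε w - N) w) (hfb : ∀ w, |f w| ≤ 1.26)
    (hfb' : ∀ w, |w * f w + ramp t ε w - N| ≤ 1) {w r : ℝ} (hr : |r| ≤ β) :
    |r * (w * f w + ramp t ε w - N) - (f w - f (w - r))| ≤
      (1.26 + β + |w| + (Ioc (t - β) (t + ε + β)).indicator (fun _ => 1 / ε) w) * r ^ 2 / 2 := by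
  set f' := fun w => w * f w + ramp t ε w - N with hf'
  have hmain := abs_le_of_abs_deriv_le_mul_abs (g := fun s => s * f' w - (f w - f (w - s)))
    (g' := fun s => f' w - f' (w - s))
    (C := 1.26 + β + |w| + (Ioc (t - β) (t + ε + β)).indicator (fun _ => 1 / ε) w) (r := r)
    (fun s => by
      have h1 := (hf (w - s)).comp s ((hasDerivAt_id s).const_sub w)
      have h2 := ((hasDerivAt_id s).mul_const (f' w)).sub (h1.const_sub (f w))
      exact h2.congr_deriv (by simp [hf'])) (by simp)
    (fun s hs => by
      have hsβ := hs.trans hr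
      have h1 := abs_ramp_sub_le_indicator (t := t) (w := w) hε hsβ
      -- Here `1.26 + |w|` would suffice; the summand `β` gives the weight the form that
      -- `steinWeight_le_sub` carries through shifts.
      have h2 : |w * f w - (w - s) * f (w - s)| ≤ (1.26 + β + |w|) * |s| := by
        have hlip : |f w - f (w - s)| ≤ 1 * |s| := by
          have := Convex.norm_image_sub_le_of_norm_hasDerivWithin_le (f := f) (f' := f') (C := 1)
            (s := univ) (x := w - s) (y := w) (fun x _ => (hf x).hasDerivWithinAt)
            (fun x _ => hfb' x) convex_univ (mem_univ _) (mem_univ _)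
          simpa using this
        calc |w * f w - (w - s) * f (w - s)| = |w * (f w - f (w - s)) + s * f (w - s)| := by
              congr 1; ring
          _ ≤ |w| * |f w - f (w - s)| + |s| * |f (w - s)| := by
              refine (abs_add_le _ _).trans ?_
              rw [abs_mul, abs_mul]
          _ ≤ |w| * (1 * |s|) + |s| * 1.26 := by gcongr; exact hfb _
          _ ≤ _ := by nlinarith [abs_nonneg s, abs_nonneg w, (abs_nonneg s).trans hsβ]
      calc |f' w - f' (w - s)|
          = |(w * f w - (w - s) * f (w - s)) + (ramp t ε w - ramp t ε (w - s))| := by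
            congr 1; simp only [hf']; ring
        _ ≤ _ := (abs_add_le _ _).trans (by rw [add_mul]; exact add_le_add h2 h1))
  exact hmain

/-! ### Local dependence: counting and moment bounds -/

/-- A family of centred random variables bounded by `b`, together with neighbourhoods `N k` of at
most `m` indices such that `X k` is independent of the sum of the variables outside of `N k`, and
such that products of pairs with no neighbouring indices are independent. -/
structure IsLocallyDependent {V Ω : Type*} [Fintype V] [MeasurableSpace Ω]
    (X : V → Ω → ℝ) (N : V → Finset V) (m : ℕ) (b : ℝ) (P : Measure Ω) : Prop where
  measurable : ∀ k, Measurable (X k)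
  bound : ∀ k, ∀ᵐ ω ∂P, |X k ω| ≤ b
  integral_eq_zero : ∀ k, ∫ ω, X k ω ∂P = 0
  symm : ∀ {i j}, j ∈ N i → i ∈ N j
  card_le : ∀ k, (N k).card ≤ m
  indep : ∀ k, IndepFun (X k) (fun ω => ∑ j, X j ω - ∑ j ∈ N k, X j ω) P
  indep_pair : ∀ {k j l n}, l ∉ N k → l ∉ N j → n ∉ N k → n ∉ N j →
    IndepFun (fun ω => X k ω * X j ω) (fun ω => X l ω * X n ω) P

section Deterministic

variable {V : Type*} [Fintype V]

lemma sum_sum_nbhd_comm {N : V → Finset V} (hN : ∀ {i j}, j ∈ N i → i ∈ N j) (g : V → ℝ) :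
    ∑ k, ∑ j ∈ N k, g j = ∑ k, (N k).card * g k := by
  rw [Finset.sum_comm' (t' := Finset.univ) (s' := N)
    (fun x y => ⟨fun h => ⟨hN h.2, Finset.mem_univ _⟩, fun h => ⟨Finset.mem_univ _, hN h.1⟩⟩)]
  simp

lemma sum_sum_nbhd_le {N : V → Finset V} {m : ℕ} (hN : ∀ {i j}, j ∈ N i → i ∈ N j)
    (hm : ∀ k, (N k).card ≤ m) {g : V → ℝ} (hg : ∀ k, 0 ≤ g k) :
    ∑ k, ∑ j ∈ N k, g j ≤ m * ∑ k, g k := by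
  rw [sum_sum_nbhd_comm hN, Finset.mul_sum]
  gcongr with k
  · exact hg k
  · exact hm k

lemma sum_nbhd_const_le {N : V → Finset V} {m : ℕ} (hm : ∀ k, (N k).card ≤ m) {g : V → ℝ}
    (hg : ∀ k, 0 ≤ g k) : ∑ k, ∑ _j ∈ N k, g k ≤ m * ∑ k, g k := by
  rw [Finset.mul_sum]
  gcongr with k
  rw [Finset.sum_const, nsmul_eq_mul]
  gcongr
  · exact hg k
  · exact hm k

/-- Cauchy–Schwarz on the neighbourhood gives one factor `m`, then `a b² ≤ a³/3 + 2b³/3` and double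
counting give the other. -/
lemma sum_abs_mul_sq_sum_nbhd_le {N : V → Finset V} {m : ℕ} (hN : ∀ {i j}, j ∈ N i → i ∈ N j)
    (hm : ∀ k, (N k).card ≤ m) (x : V → ℝ) :
    ∑ k, |x k| * (∑ j ∈ N k, x j) ^ 2 ≤ (m : ℝ) ^ 2 * ∑ k, |x k| ^ 3 := by
  have h1 : ∀ k, |x k| * (∑ j ∈ N k, x j) ^ 2 ≤
      (m : ℝ) * ∑ j ∈ N k, (|x k| ^ 3 / 3 + 2 / 3 * |x j| ^ 3) := fun k => by
    have hcs : (∑ j ∈ N k, x j) ^ 2 ≤ m * ∑ j ∈ N k, x j ^ 2 :=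
      sq_sum_le_card_mul_sum_sq.trans (by gcongr; exact hm k)
    calc |x k| * (∑ j ∈ N k, x j) ^ 2 ≤ |x k| * (m * ∑ j ∈ N k, x j ^ 2) := by gcongr
      _ = m * ∑ j ∈ N k, |x k| * |x j| ^ 2 := by simp_rw [sq_abs, ← Finset.mul_sum]; ring
      _ ≤ _ := by
        gcongr with j
        have ha := abs_nonneg (x k)
        have hb := abs_nonneg (x j)
        -- `a³ + 2b³ - 3ab² = (a + 2b)(a - b)²`.
        nlinarith [mul_nonneg (add_nonneg ha (add_nonneg hb hb)) (sq_nonneg (|x k| - |x j|))]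
  have h3 : ∀ k, 0 ≤ |x k| ^ 3 := fun k => by positivity
  calc ∑ k, |x k| * (∑ j ∈ N k, x j) ^ 2
      ≤ ∑ k, (m : ℝ) * ∑ j ∈ N k, (|x k| ^ 3 / 3 + 2 / 3 * |x j| ^ 3) :=
        Finset.sum_le_sum fun k _ => h1 k
    _ = (m : ℝ) * (∑ k, ∑ _j ∈ N k, |x k| ^ 3 / 3 + 2 / 3 * ∑ k, ∑ j ∈ N k, |x j| ^ 3) := by
        simp_rw [Finset.sum_add_distrib, ← Finset.mul_sum]
        rw [Finset.sum_add_distrib, ← Finset.mul_sum]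
    _ ≤ (m : ℝ) * (m * ∑ k, |x k| ^ 3 / 3 + 2 / 3 * (m * ∑ k, |x k| ^ 3)) := by
        have a1 := sum_nbhd_const_le hm (g := fun k => |x k| ^ 3 / 3) (fun k => by positivity)
        have a2 := sum_sum_nbhd_le hN hm h3
        gcongr
    _ = (m : ℝ) ^ 2 * ∑ k, |x k| ^ 3 := by
        rw [← Finset.sum_div]
        ring

end Deterministic

section General

variable {Ω : Type*} [MeasurableSpace Ω] {P : Measure Ω} [IsProbabilityMeasure P]

/-- If every member of a finite family is uncorrelated with all but at most `K` members, then the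
variance of the sum is at most `K` times the sum of the second moments. -/
lemma variance_sum_le_of_covariance_eq_zero {ι : Type*} [Fintype ι] {A : ι → Ω → ℝ}
    (hA : ∀ p, MemLp (A p) 2 P) {M : ι → Finset ι} {K : ℕ} (hM : ∀ {p q}, q ∈ M p → p ∈ M q)
    (hK : ∀ p, (M p).card ≤ K) (hcov : ∀ p q, q ∉ M p → cov[A p, A q; P] = 0) :
    Var[fun ω => ∑ p, A p ω; P] ≤ K * ∑ p, ∫ ω, A p ω ^ 2 ∂P := by
  have hvar : ∀ p, Var[A p; P] ≤ ∫ ω, A p ω ^ 2 ∂P := fun p => by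
    rw [variance_eq_sub (hA p)]
    simpa using sq_nonneg (∫ ω, A p ω ∂P)
  have hcovle : ∀ p q, cov[A p, A q; P] ≤ Var[A p; P] / 2 + Var[A q; P] / 2 := fun p q => by
    have := variance_nonneg (A p - A q) P
    rw [variance_sub (hA p) (hA q)] at this
    linarith
  have e : Var[fun ω => ∑ p, A p ω; P] = Var[∑ p, A p; P] := by
    congr 1
    ext ω
    simp
  rw [e, variance_sum hA]
  calc ∑ p, ∑ q, cov[A p, A q; P] = ∑ p, ∑ q ∈ M p, cov[A p, A q; P] :=
        Finset.sum_congr rfl fun p _ =>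
          (Finset.sum_subset (Finset.subset_univ _) fun q _ hq => hcov p q hq).symm
    _ ≤ ∑ p, ∑ q ∈ M p, (Var[A p; P] / 2 + Var[A q; P] / 2) := by
        gcongr with p _ q
        exact hcovle p q
    _ = ∑ p, ∑ _q ∈ M p, Var[A p; P] / 2 + ∑ p, ∑ q ∈ M p, Var[A q; P] / 2 := by
        simp_rw [Finset.sum_add_distrib]
    _ ≤ K * ∑ p, Var[A p; P] / 2 + K * ∑ p, Var[A p; P] / 2 := by
        have h0 : ∀ p, 0 ≤ Var[A p; P] / 2 := fun p => by
          have := variance_nonneg (A p) P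
          positivity
        exact add_le_add (sum_nbhd_const_le hK h0) (sum_sum_nbhd_le hM hK h0)
    _ = K * ∑ p, Var[A p; P] := by rw [← Finset.sum_div]; ring
    _ ≤ _ := by
        gcongr with p
        exact hvar p

lemma integral_abs_le_of_integral_sq_le {f : Ω → ℝ} (hf : MemLp f ∞ P) {Q : ℝ} (hQ : 0 ≤ Q)
    (h : ∫ ω, f ω ^ 2 ∂P ≤ Q ^ 2) : ∫ ω, |f ω| ∂P ≤ Q := by
  have h2 : MemLp (fun ω => |f ω|) 2 P := (hf.mono_exponent le_top).norm
  have := variance_nonneg (fun ω => |f ω|) P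
  rw [variance_eq_sub h2] at this
  simp only [Pi.pow_apply, sq_abs] at this
  exact le_of_sq_le_sq (by linarith) hQ

end General

namespace IsLocallyDependent

variable {V Ω : Type*} [Fintype V] [MeasurableSpace Ω] {P : Measure Ω}
  {X : V → Ω → ℝ} {N : V → Finset V} {m : ℕ} {b : ℝ}

lemma memLp_top (hX : IsLocallyDependent X N m b P) (k : V) : MemLp (X k) ∞ P :=
  memLp_top_of_bound (hX.measurable k).aestronglyMeasurable b (hX.bound k)

lemma measurable_sum (hX : IsLocallyDependent X N m b P) (s : Finset V) :
    Measurable (fun ω => ∑ j ∈ s, X j ω) :=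
  Finset.measurable_fun_sum s fun k _ => hX.measurable k

lemma memLp_top_mul {f g : Ω → ℝ} (hf : MemLp f ∞ P) (hg : MemLp g ∞ P) :
    MemLp (fun ω => f ω * g ω) ∞ P :=
  MemLp.mul' (p := ∞) (q := ∞) (r := ∞) hg hf

lemma ae_abs_sum_nbhd_le (hX : IsLocallyDependent X N m b P) (hb : 0 ≤ b) :
    ∀ᵐ ω ∂P, ∀ k, |∑ j ∈ N k, X j ω| ≤ m * b := by
  filter_upwards [ae_all_iff.2 hX.bound] with ω hω k
  calc |∑ j ∈ N k, X j ω| ≤ ∑ j ∈ N k, |X j ω| := Finset.abs_sum_le_sum_abs _ _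
    _ ≤ ∑ j ∈ N k, b := Finset.sum_le_sum fun j _ => hω j
    _ ≤ m * b := by
      rw [Finset.sum_const, nsmul_eq_mul]
      gcongr
      exact hX.card_le k

/-- Such a pair has an end in the neighbourhood of `k` or of `j`, and its other end neighbours the
first: two starting points, two choices of end, `m²` pairs each. The swap `sw` treats the second end
like the first. -/
lemma card_pairs_le (hX : IsLocallyDependent X N m b P) [DecidableEq V] (k j : V) :
    ((Finset.univ.sigma N).filter fun q : (_ : V) × V =>
      q.1 ∈ N k ∨ q.1 ∈ N j ∨ q.2 ∈ N k ∨ q.2 ∈ N j).card ≤ 4 * m ^ 2 := by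
  have h1 : ∀ i, ((N i).sigma N).card ≤ m ^ 2 := fun i => by
    rw [Finset.card_sigma, sq]
    calc ∑ a ∈ N i, (N a).card ≤ ∑ a ∈ N i, m := Finset.sum_le_sum fun a _ => hX.card_le a
      _ = (N i).card * m := by simp
      _ ≤ m * m := Nat.mul_le_mul_right _ (hX.card_le i)
  set sw : (_ : V) × V → (_ : V) × V := fun q => ⟨q.2, q.1⟩
  have h2 : ∀ i, (((N i).sigma N).image sw).card ≤ m ^ 2 := fun i =>
    Finset.card_image_le.trans (h1 i)
  have hsub : ((Finset.univ.sigma N).filter fun q : (_ : V) × V =>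
      q.1 ∈ N k ∨ q.1 ∈ N j ∨ q.2 ∈ N k ∨ q.2 ∈ N j) ⊆
      (((N k).sigma N ∪ (N j).sigma N) ∪ (((N k).sigma N).image sw ∪ ((N j).sigma N).image sw)) := by
    rintro ⟨l, n⟩ hq
    simp only [Finset.mem_filter, Finset.mem_sigma, Finset.mem_univ, true_and] at hq
    simp only [Finset.mem_union, Finset.mem_sigma, Finset.mem_image]
    obtain ⟨hln, h | h | h | h⟩ := hq
    · exact Or.inl (Or.inl ⟨h, hln⟩)
    · exact Or.inl (Or.inr ⟨h, hln⟩)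
    · exact Or.inr (Or.inl ⟨⟨n, l⟩, ⟨h, hX.symm hln⟩, rfl⟩)
    · exact Or.inr (Or.inr ⟨⟨n, l⟩, ⟨h, hX.symm hln⟩, rfl⟩)
  refine (Finset.card_le_card hsub).trans ?_
  refine (Finset.card_union_le _ _).trans ?_
  have h3 := Finset.card_union_le ((N k).sigma N) ((N j).sigma N)
  have h4 := Finset.card_union_le (((N k).sigma N).image sw) (((N j).sigma N).image sw)
  have := h1 k
  have := h1 j
  have := h2 k
  have := h2 j
  omega

lemma memLp_top_sum (hX : IsLocallyDependent X N m b P) (s : Finset V) :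
    MemLp (fun ω => ∑ j ∈ s, X j ω) ∞ P :=
  memLp_finsetSum s fun k _ => hX.memLp_top k

lemma integral_mul_comp_eq_zero (hX : IsLocallyDependent X N m b P) (k : V) {g : ℝ → ℝ}
    (hg : Measurable g) : ∫ ω, X k ω * g (∑ j, X j ω - ∑ j ∈ N k, X j ω) ∂P = 0 := by
  have hW := (hX.measurable_sum Finset.univ).sub (hX.measurable_sum (N k))
  have := ((hX.indep k).comp measurable_id hg).integral_fun_mul_eq_mul_integral
    (hX.measurable k).aestronglyMeasurable (hg.comp hW).aestronglyMeasurable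
  simp only [Function.comp_def, id] at this
  rw [this, hX.integral_eq_zero, zero_mul]

variable [IsProbabilityMeasure P]

lemma memLp_top_pow {f : Ω → ℝ} (hf : MemLp f ∞ P) (n : ℕ) : MemLp (fun ω => f ω ^ n) ∞ P := by
  induction n with
  | zero => simpa using memLp_const (1 : ℝ)
  | succ n ih => simpa only [pow_succ] using memLp_top_mul ih hf

lemma integrable_of_memLp_top {f : Ω → ℝ} (hf : MemLp f ∞ P) : Integrable f P :=
  hf.integrable le_top

/-- `X k` is centred and independent of the sum outside its neighbourhood, so only neighbours
contribute to `E[X k * W]`. -/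
lemma integral_sum_mul_sum_nbhd (hX : IsLocallyDependent X N m b P) :
    ∫ ω, ∑ k, X k ω * ∑ j ∈ N k, X j ω ∂P = ∫ ω, (∑ k, X k ω) ^ 2 ∂P := by
  have h1 : ∀ k, Integrable (fun ω => X k ω * ∑ j ∈ N k, X j ω) P := fun k =>
    integrable_of_memLp_top (memLp_top_mul (hX.memLp_top k) (hX.memLp_top_sum _))
  have h2 : ∀ k, Integrable (fun ω => X k ω * ∑ j, X j ω) P := fun k =>
    integrable_of_memLp_top (memLp_top_mul (hX.memLp_top k) (hX.memLp_top_sum _))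
  simp_rw [sq, Finset.sum_mul]
  rw [integral_finsetSum _ fun k _ => h1 k, integral_finsetSum _ fun k _ => h2 k]
  refine Finset.sum_congr rfl fun k _ => ?_
  have h3 := hX.integral_mul_comp_eq_zero k measurable_id
  simp only [id, mul_sub] at h3
  rw [integral_sub (h2 k) (h1 k)] at h3
  linarith

/-- The variance of the sum of the products over neighbouring pairs. -/
lemma variance_sum_mul_sum_nbhd_le (hX : IsLocallyDependent X N m b P) :
    Var[fun ω => ∑ k, X k ω * ∑ j ∈ N k, X j ω; P] ≤
      4 * ((m : ℝ) ^ 3 * ∑ k, ∫ ω, X k ω ^ 4 ∂P) := by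
  classical
  let ι := ↥(Finset.univ.sigma N)
  have hcoe : ∀ g : V → V → ℝ, ∑ p : ι, g p.1.1 p.1.2 = ∑ k, ∑ j ∈ N k, g k j := fun g => by
    rw [← Finset.sum_sigma (f := fun q : (_ : V) × V => g q.1 q.2)]
    exact Finset.sum_coe_sort (Finset.univ.sigma N) fun q => g q.1 q.2
  let A : ι → Ω → ℝ := fun p ω => X p.1.1 ω * X p.1.2 ω
  have hA : ∀ p, MemLp (A p) 2 P := fun p =>
    (memLp_top_mul (hX.memLp_top _) (hX.memLp_top _)).mono_exponent le_top
  let M : ι → Finset ι := fun p => Finset.univ.filter fun q =>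
    q.1.1 ∈ N p.1.1 ∨ q.1.1 ∈ N p.1.2 ∨ q.1.2 ∈ N p.1.1 ∨ q.1.2 ∈ N p.1.2
  have hM : ∀ {p q}, q ∈ M p → p ∈ M q := fun {p q} h => by
    simp only [M, Finset.mem_filter, Finset.mem_univ, true_and] at h ⊢
    rcases h with h | h | h | h
    · exact Or.inl (hX.symm h)
    · exact Or.inr (Or.inr (Or.inl (hX.symm h)))
    · exact Or.inr (Or.inl (hX.symm h))
    · exact Or.inr (Or.inr (Or.inr (hX.symm h)))
  have hK : ∀ p, (M p).card ≤ 4 * m ^ 2 := fun p => by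
    refine le_trans ?_ (hX.card_pairs_le p.1.1 p.1.2)
    refine Finset.card_le_card_of_injOn Subtype.val (fun q hq => ?_)
      Subtype.val_injective.injOn
    simp only [M, Finset.coe_filter, Finset.mem_univ, true_and, mem_ofPred_eq] at hq ⊢
    exact ⟨q.2, hq⟩
  have hcov : ∀ p q, q ∉ M p → cov[A p, A q; P] = 0 := fun p q h => by
    simp only [M, Finset.mem_filter, Finset.mem_univ, true_and, not_or] at h
    exact (hX.indep_pair h.1 h.2.1 h.2.2.1 h.2.2.2).covariance_eq_zero (hA p) (hA q)
  have hmain := variance_sum_le_of_covariance_eq_zero hA hM hK hcov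
  have e : (fun ω => ∑ k, X k ω * ∑ j ∈ N k, X j ω) = fun ω => ∑ p, A p ω := by
    ext ω
    simp_rw [Finset.mul_sum]
    exact (hcoe fun k j => X k ω * X j ω).symm
  rw [e]
  refine hmain.trans ?_
  have h4 : ∀ k, Integrable (fun ω => X k ω ^ 4) P := fun k =>
    integrable_of_memLp_top (memLp_top_pow (hX.memLp_top k) 4)
  have h0 : ∀ k, 0 ≤ (∫ ω, X k ω ^ 4 ∂P) / 2 := fun k =>
    div_nonneg (integral_nonneg fun ω => by positivity) two_pos.le
  have h5 : ∀ k j, ∫ ω, (X k ω * X j ω) ^ 2 ∂P ≤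
      (∫ ω, X k ω ^ 4 ∂P) / 2 + (∫ ω, X j ω ^ 4 ∂P) / 2 := fun k j => by
    rw [← integral_div, ← integral_div, ← integral_add ((h4 k).div_const 2) ((h4 j).div_const 2)]
    refine integral_mono (integrable_of_memLp_top (memLp_top_pow
      (memLp_top_mul (hX.memLp_top k) (hX.memLp_top j)) 2))
      (((h4 k).div_const 2).add ((h4 j).div_const 2)) fun ω => ?_
    simp only
    nlinarith [sq_nonneg (X k ω ^ 2 - X j ω ^ 2)]
  have h6 : ∑ p : ι, ∫ ω, A p ω ^ 2 ∂P ≤ m * ∑ k, ∫ ω, X k ω ^ 4 ∂P := by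
    calc ∑ p : ι, ∫ ω, A p ω ^ 2 ∂P = ∑ k, ∑ j ∈ N k, ∫ ω, (X k ω * X j ω) ^ 2 ∂P :=
          hcoe fun k j => ∫ ω, (X k ω * X j ω) ^ 2 ∂P
      _ ≤ ∑ k, ∑ j ∈ N k, ((∫ ω, X k ω ^ 4 ∂P) / 2 + (∫ ω, X j ω ^ 4 ∂P) / 2) := by
          gcongr with k _ j
          exact h5 k j
      _ = ∑ k, ∑ _j ∈ N k, (∫ ω, X k ω ^ 4 ∂P) / 2 + ∑ k, ∑ j ∈ N k, (∫ ω, X j ω ^ 4 ∂P) / 2 := by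
          simp_rw [Finset.sum_add_distrib]
      _ ≤ m * ∑ k, (∫ ω, X k ω ^ 4 ∂P) / 2 + m * ∑ k, (∫ ω, X k ω ^ 4 ∂P) / 2 :=
          add_le_add (sum_nbhd_const_le hX.card_le h0) (sum_sum_nbhd_le hX.symm hX.card_le h0)
      _ = _ := by rw [← Finset.sum_div]; ring
  push_cast
  calc 4 * (m : ℝ) ^ 2 * ∑ p : ι, ∫ ω, A p ω ^ 2 ∂P
      ≤ 4 * (m : ℝ) ^ 2 * (m * ∑ k, ∫ ω, X k ω ^ 4 ∂P) := by gcongr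
    _ = _ := by ring

/-- A decoupling estimate: the weights `|X k| * (∑ j ∈ N k, X j) ^ 2` can be separated from a
function of the whole sum, at the cost of enlarging the function twice. -/
lemma sum_integral_mul_comp_le (hX : IsLocallyDependent X N m b P) {J J₁ J₂ : ℝ → ℝ} {β : ℝ}
    (hb : 0 ≤ b) (hβ : m * b ≤ β) (hJ0 : ∀ w, 0 ≤ J w) (hJ₁ : Measurable J₁)
    (hJP : MemLp (fun ω => J (∑ k, X k ω)) ∞ P)
    (hJ₁P : ∀ k, MemLp (fun ω => J₁ (∑ j, X j ω - ∑ j ∈ N k, X j ω)) ∞ P)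
    (hJ₂P : MemLp (fun ω => J₂ (∑ k, X k ω)) ∞ P)
    (h₁ : ∀ w r, |r| ≤ β → J w ≤ J₁ (w - r)) (h₂ : ∀ w r, |r| ≤ β → J₁ (w - r) ≤ J₂ w) :
    ∑ k, ∫ ω, |X k ω| * (∑ j ∈ N k, X j ω) ^ 2 * J (∑ j, X j ω) ∂P ≤
      (m : ℝ) ^ 2 * (∑ k, ∫ ω, |X k ω| ^ 3 ∂P) * ∫ ω, J₂ (∑ k, X k ω) ∂P := by
  have hae := hX.ae_abs_sum_nbhd_le hb
  have habs : ∀ k, MemLp (fun ω => |X k ω|) ∞ P := fun k => (hX.memLp_top k).norm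
  have hi1 : ∀ k, Integrable
      (fun ω => |X k ω| * (∑ j ∈ N k, X j ω) ^ 2 * J (∑ j, X j ω)) P := fun k =>
    integrable_of_memLp_top (memLp_top_mul
      (memLp_top_mul (habs k) (memLp_top_pow (hX.memLp_top_sum _) 2)) hJP)
  have hi2 : ∀ k, Integrable (fun ω => |X k ω| ^ 3 * J (∑ j, X j ω)) P := fun k =>
    integrable_of_memLp_top (memLp_top_mul (memLp_top_pow (habs k) 3) hJP)
  have hmeas : ∀ k, Measurable fun ω => ∑ j, X j ω - ∑ j ∈ N k, X j ω := fun k =>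
    (hX.measurable_sum Finset.univ).sub (hX.measurable_sum (N k))
  have hdec : ∀ k, ∫ ω, |X k ω| ^ 3 * J (∑ j, X j ω) ∂P ≤
      (∫ ω, |X k ω| ^ 3 ∂P) * ∫ ω, J₂ (∑ j, X j ω) ∂P := fun k => by
    have hind : ∫ ω, |X k ω| ^ 3 * J₁ (∑ j, X j ω - ∑ j ∈ N k, X j ω) ∂P =
        (∫ ω, |X k ω| ^ 3 ∂P) * ∫ ω, J₁ (∑ j, X j ω - ∑ j ∈ N k, X j ω) ∂P := by
      have hc : Measurable fun x : ℝ => |x| ^ 3 := by fun_prop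
      exact ((hX.indep k).comp hc hJ₁).integral_fun_mul_eq_mul_integral
        (hc.comp (hX.measurable k)).aestronglyMeasurable
        (hJ₁.comp (hmeas k)).aestronglyMeasurable
    calc ∫ ω, |X k ω| ^ 3 * J (∑ j, X j ω) ∂P
        ≤ ∫ ω, |X k ω| ^ 3 * J₁ (∑ j, X j ω - ∑ j ∈ N k, X j ω) ∂P := by
          refine integral_mono_ae (hi2 k) (integrable_of_memLp_top
            (memLp_top_mul (memLp_top_pow (habs k) 3) (hJ₁P k))) ?_
          filter_upwards [hae] with ω hω
          exact mul_le_mul_of_nonneg_left (h₁ _ _ ((hω k).trans hβ)) (by positivity)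
      _ = _ := hind
      _ ≤ _ := by
          refine mul_le_mul_of_nonneg_left ?_ (integral_nonneg fun ω => by positivity)
          refine integral_mono_ae (integrable_of_memLp_top (hJ₁P k))
            (integrable_of_memLp_top hJ₂P) ?_
          filter_upwards [hae] with ω hω
          exact h₂ _ _ ((hω k).trans hβ)
  calc ∑ k, ∫ ω, |X k ω| * (∑ j ∈ N k, X j ω) ^ 2 * J (∑ j, X j ω) ∂P
      = ∫ ω, ∑ k, |X k ω| * (∑ j ∈ N k, X j ω) ^ 2 * J (∑ j, X j ω) ∂P :=
        (integral_finsetSum _ fun k _ => hi1 k).symm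
    -- The pointwise bound comes before independence is used: `X k` is independent of the outside
    -- sum, but its neighbours need not be. It applies because the factor `J (W)` is common to all
    -- `k`.
    _ ≤ ∫ ω, (m : ℝ) ^ 2 * ∑ k, |X k ω| ^ 3 * J (∑ j, X j ω) ∂P := by
        refine integral_mono (integrable_finsetSum _ fun k _ => hi1 k)
          ((integrable_finsetSum _ fun k _ => hi2 k).const_mul _) fun ω => ?_
        simp only
        rw [← Finset.sum_mul, ← Finset.sum_mul, ← mul_assoc]
        exact mul_le_mul_of_nonneg_right
          (sum_abs_mul_sq_sum_nbhd_le hX.symm hX.card_le fun k => X k ω) (hJ0 _)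
    _ = (m : ℝ) ^ 2 * ∑ k, ∫ ω, |X k ω| ^ 3 * J (∑ j, X j ω) ∂P := by
        rw [integral_const_mul, integral_finsetSum _ fun k _ => hi2 k]
    _ ≤ (m : ℝ) ^ 2 * ∑ k, (∫ ω, |X k ω| ^ 3 ∂P) * ∫ ω, J₂ (∑ j, X j ω) ∂P := by
        gcongr with k
        exact hdec k
    _ = _ := by rw [← Finset.sum_mul, mul_assoc]

end IsLocallyDependent

/-! ### Stein's identity and its error terms -/

/-- The function that controls the remainder in Stein's identity for a ramp function. -/
noncomputable def steinWeight (t ε β w : ℝ) : ℝ :=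
  1.26 + β + |w| + (Ioc (t - β) (t + ε + β)).indicator (fun _ => 1 / ε) w

lemma indicator_one_div_mem_Icc {ε : ℝ} (hε : 0 < ε) (s : Set ℝ) (w : ℝ) :
    s.indicator (fun _ => 1 / ε) w ∈ Icc 0 (1 / ε) := by
  have : 0 ≤ 1 / ε := by positivity
  exact ⟨indicator_nonneg (fun _ _ => this) w, indicator_le_self' (fun _ _ => this) w⟩

lemma steinWeight_nonneg {t ε β : ℝ} (hε : 0 < ε) (hβ : 0 ≤ β) (w : ℝ) :
    0 ≤ steinWeight t ε β w := by
  have := (indicator_one_div_mem_Icc hε (Ioc (t - β) (t + ε + β)) w).1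
  unfold steinWeight
  positivity

lemma measurable_steinWeight (t ε β : ℝ) : Measurable (steinWeight t ε β) := by
  unfold steinWeight
  exact (measurable_const.add measurable_norm).add (measurable_const.indicator measurableSet_Ioc)

/-- A shift by at most `β` changes `|w|` by at most `β` and leaves the interval enlarged by `β`;
raising the parameter by `β` pays for both. -/
lemma steinWeight_le_sub {t ε β γ w r : ℝ} (hε : 0 < ε) (hr : |r| ≤ β) :
    steinWeight t ε γ w ≤ steinWeight t ε (γ + β) (w - r) := by
  unfold steinWeight
  have h1 : |w| ≤ |w - r| + |r| := by
    simpa using abs_add_le (w - r) r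
  have hr' := abs_le.1 hr
  have h2 : (Ioc (t - γ) (t + ε + γ)).indicator (fun _ => 1 / ε) w ≤
      (Ioc (t - (γ + β)) (t + ε + (γ + β))).indicator (fun _ => 1 / ε) (w - r) := by
    by_cases hw : w ∈ Ioc (t - γ) (t + ε + γ)
    · rw [indicator_of_mem hw, indicator_of_mem]
      constructor <;> linarith [hw.1, hw.2]
    · rw [indicator_of_notMem hw]
      exact (indicator_one_div_mem_Icc hε _ _).1
  linarith

section

variable {Ω : Type*} [MeasurableSpace Ω] {P : Measure Ω} [IsProbabilityMeasure P]

lemma memLp_top_steinWeight {t ε β : ℝ} (hε : 0 < ε) {U : Ω → ℝ} (hU : MemLp U ∞ P)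
    (hUm : Measurable U) : MemLp (fun ω => steinWeight t ε β (U ω)) ∞ P := by
  refine MemLp.add (MemLp.add (memLp_const _) hU.norm) ?_
  refine memLp_top_of_bound (C := 1 / ε) ?_ (Eventually.of_forall fun ω => ?_)
  · exact ((measurable_const.indicator measurableSet_Ioc).comp hUm).aestronglyMeasurable
  · have := indicator_one_div_mem_Icc hε (Ioc (t - β) (t + ε + β)) (U ω)
    rw [Real.norm_eq_abs, abs_of_nonneg this.1]
    exact this.2

lemma integral_steinWeight_le {t ε β : ℝ} {U : Ω → ℝ} (hU : MemLp U ∞ P)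
    (hUm : Measurable U) (hU2 : ∫ ω, U ω ^ 2 ∂P = 1) :
    ∫ ω, steinWeight t ε β (U ω) ∂P ≤
      2.26 + β + (P.map U).real (Ioc (t - β) (t + ε + β)) / ε := by
  have h1 : ∫ ω, |U ω| ∂P ≤ 1 := integral_abs_le_of_integral_sq_le hU zero_le_one (by simp [hU2])
  have hind : Integrable
      (fun ω => (Ioc (t - β) (t + ε + β)).indicator (fun _ => 1 / ε) (U ω)) P :=
    (integrable_const (1 / ε)).indicator (hUm measurableSet_Ioc)
  have h2 : ∫ ω, (Ioc (t - β) (t + ε + β)).indicator (fun _ => 1 / ε) (U ω) ∂P =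
      (P.map U).real (Ioc (t - β) (t + ε + β)) / ε := by
    rw [← integral_map (f := (Ioc (t - β) (t + ε + β)).indicator (fun _ => 1 / ε))
      hUm.aemeasurable (measurable_const.indicator measurableSet_Ioc).aestronglyMeasurable,
      integral_indicator_const _ measurableSet_Ioc, smul_eq_mul]
    ring
  have hUi : Integrable (fun ω => |U ω|) P := (hU.integrable le_top).norm
  unfold steinWeight
  have hi : Integrable (fun ω => 1.26 + β + |U ω|) P := (integrable_const _).add hUi
  rw [integral_add hi hind, h2,
    integral_add (integrable_const _) hUi]
  simp only [integral_const, probReal_univ, one_smul]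
  linarith

end

namespace IsLocallyDependent

variable {V Ω : Type*} [Fintype V] [MeasurableSpace Ω] {P : Measure Ω} [IsProbabilityMeasure P]
  {X : V → Ω → ℝ} {N : V → Finset V} {m : ℕ} {b : ℝ}

lemma integral_abs_one_sub_le (hX : IsLocallyDependent X N m b P) {Q : ℝ} (hQ0 : 0 ≤ Q)
    (hvar : ∫ ω, (∑ k, X k ω) ^ 2 ∂P = 1)
    (hQ : (m : ℝ) ^ 3 * ∑ k, ∫ ω, X k ω ^ 4 ∂P ≤ Q ^ 2) :
    ∫ ω, |1 - ∑ k, X k ω * ∑ j ∈ N k, X j ω| ∂P ≤ 2 * Q := by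
  have hT : MemLp (fun ω => ∑ k, X k ω * ∑ j ∈ N k, X j ω) ∞ P :=
    memLp_finsetSum _ fun k _ => memLp_top_mul (hX.memLp_top k) (hX.memLp_top_sum _)
  refine integral_abs_le_of_integral_sq_le ((memLp_const 1).sub hT) (by positivity) ?_
  have h1 := hX.variance_sum_mul_sum_nbhd_le
  rw [variance_eq_integral hT.aestronglyMeasurable.aemeasurable,
    hX.integral_sum_mul_sum_nbhd, hvar] at h1
  have e : ∀ ω, (1 - ∑ k, X k ω * ∑ j ∈ N k, X j ω) ^ 2 =
      (∑ k, X k ω * ∑ j ∈ N k, X j ω - 1) ^ 2 := fun ω => by ring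
  simp_rw [Pi.sub_apply, e]
  linarith

/-- Stein's method: the normal approximation of a sum of locally dependent random variables, tested
on a ramp function. -/
lemma abs_integral_ramp_sub_le (hX : IsLocallyDependent X N m b P) {β R Q t ε : ℝ}
    (hb : 0 ≤ b) (hβ : m * b ≤ β) (hvar : ∫ ω, (∑ k, X k ω) ^ 2 ∂P = 1)
    (hR : (m : ℝ) ^ 2 * ∑ k, ∫ ω, |X k ω| ^ 3 ∂P ≤ R) (hQ0 : 0 ≤ Q)
    (hQ : (m : ℝ) ^ 3 * ∑ k, ∫ ω, X k ω ^ 4 ∂P ≤ Q ^ 2) (hε : 0 < ε) :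
    |∫ ω, ramp t ε (∑ k, X k ω) ∂P - ∫ x, ramp t ε x ∂gaussianReal 0 1| ≤
      2 * Q + R / 2 * (2.26 + 3 * β +
        (P.map fun ω => ∑ k, X k ω).real (Ioc (t - 3 * β) (t + ε + 3 * β)) / ε) := by
  obtain ⟨f, hf⟩ := exists_stein_solution (continuous_ramp t ε) (ramp_nonneg t ε)
    (ramp_le_one t ε)
  set n := ∫ x, ramp t ε x ∂gaussianReal 0 1
  set f' : ℝ → ℝ := fun w => w * f w + ramp t ε w - n with hf'
  have hfc : Continuous f := continuous_iff_continuousAt.2 fun w => (hf w).1.continuousAt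
  have hf'c : Continuous f' :=
    ((continuous_id.mul hfc).add (continuous_ramp t ε)).sub continuous_const
  have hβ0 : 0 ≤ β := le_trans (by positivity) hβ
  set W : Ω → ℝ := fun ω => ∑ k, X k ω with hW
  set η : V → Ω → ℝ := fun k ω => ∑ j ∈ N k, X j ω with hη
  have hWm : Measurable W := hX.measurable_sum Finset.univ
  have hηm : ∀ k, Measurable (η k) := fun k => hX.measurable_sum (N k)
  have hWL : MemLp W ∞ P := hX.memLp_top_sum Finset.univ
  have hηL : ∀ k, MemLp (η k) ∞ P := fun k => hX.memLp_top_sum (N k)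
  have hbdd : ∀ {g : ℝ → ℝ} {U : Ω → ℝ} {C : ℝ}, Continuous g → Measurable U →
      (∀ w, |g w| ≤ C) → MemLp (fun ω => g (U ω)) ∞ P := fun {g U C} hg hU hC =>
    memLp_top_of_bound (hg.measurable.comp hU).aestronglyMeasurable C
      (Eventually.of_forall fun ω => hC _)
  have hfW := hbdd hfc hWm fun w => (hf w).2.1
  have hf'W := hbdd hf'c hWm fun w => (hf w).2.2
  have hfWη : ∀ k, MemLp (fun ω => f (W ω - η k ω)) ∞ P := fun k =>
    hbdd hfc (hWm.sub (hηm k)) fun w => (hf w).2.1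
  have hT : MemLp (fun ω => ∑ k, X k ω * η k ω) ∞ P :=
    memLp_finsetSum _ fun k _ => memLp_top_mul (hX.memLp_top k) (hηL k)
  have hG1 : MemLp (fun ω => f' (W ω) * (1 - ∑ k, X k ω * η k ω)) ∞ P :=
    memLp_top_mul hf'W ((memLp_const 1).sub hT)
  have hG2 : ∀ k, MemLp
      (fun ω => X k ω * (η k ω * f' (W ω) - (f (W ω) - f (W ω - η k ω)))) ∞ P := fun k =>
    memLp_top_mul (hX.memLp_top k) ((memLp_top_mul (hηL k) hf'W).sub (hfW.sub (hfWη k)))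
  have hG3 : ∀ k, MemLp (fun ω => X k ω * f (W ω - η k ω)) ∞ P := fun k =>
    memLp_top_mul (hX.memLp_top k) (hfWη k)
  have hrampW : Integrable (fun ω => ramp t ε (W ω)) P := integrable_of_memLp_top <|
    hbdd (continuous_ramp t ε) hWm fun w => by
      rw [abs_of_nonneg (ramp_nonneg t ε w)]
      exact ramp_le_one t ε w
  -- Stein's identity: the terms `X k * f (W - η k)` integrate to zero and may be inserted freely.
  have hid : ∫ ω, ramp t ε (W ω) ∂P - n =
      ∫ ω, f' (W ω) * (1 - ∑ k, X k ω * η k ω) ∂P +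
        ∑ k, ∫ ω, X k ω * (η k ω * f' (W ω) - (f (W ω) - f (W ω - η k ω))) ∂P := by
    have h0 : ∑ k, ∫ ω, X k ω * f (W ω - η k ω) ∂P = 0 :=
      Finset.sum_eq_zero fun k _ => hX.integral_mul_comp_eq_zero k hfc.measurable
    have e : ∀ ω, ramp t ε (W ω) - n = f' (W ω) * (1 - ∑ k, X k ω * η k ω) +
        ∑ k, X k ω * (η k ω * f' (W ω) - (f (W ω) - f (W ω - η k ω))) -
        ∑ k, X k ω * f (W ω - η k ω) := fun ω => by
      have e1 : ∑ k, X k ω * (η k ω * f' (W ω) - (f (W ω) - f (W ω - η k ω))) =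
          (∑ k, X k ω * η k ω) * f' (W ω) - (∑ k, X k ω) * f (W ω) +
            ∑ k, X k ω * f (W ω - η k ω) := by
        rw [Finset.sum_mul, Finset.sum_mul, ← Finset.sum_sub_distrib, ← Finset.sum_add_distrib]
        exact Finset.sum_congr rfl fun k _ => by ring
      rw [e1]
      simp only [hf', hW]
      ring
    have e2 : ∫ ω, ramp t ε (W ω) ∂P - n = ∫ ω, (ramp t ε (W ω) - n) ∂P := by
      rw [integral_sub hrampW (integrable_const _)]
      simp
    have hi2 := integrable_finsetSum Finset.univ fun k _ => integrable_of_memLp_top (hG2 k)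
    have hi3 := integrable_finsetSum Finset.univ fun k _ => integrable_of_memLp_top (hG3 k)
    have hi1 := integrable_of_memLp_top hG1
    rw [e2]
    simp_rw [e]
    have hi12 : Integrable (fun ω => f' (W ω) * (1 - ∑ k, X k ω * η k ω) +
        ∑ k, X k ω * (η k ω * f' (W ω) - (f (W ω) - f (W ω - η k ω)))) P := hi1.add hi2
    rw [integral_sub hi12 hi3, integral_add hi1 hi2,
      integral_finsetSum _ fun k _ => integrable_of_memLp_top (hG2 k),
      integral_finsetSum _ fun k _ => integrable_of_memLp_top (hG3 k), h0, sub_zero]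
  have hb1 : |∫ ω, f' (W ω) * (1 - ∑ k, X k ω * η k ω) ∂P| ≤ 2 * Q := by
    refine (abs_integral_le_integral_abs).trans
      (le_trans ?_ (hX.integral_abs_one_sub_le hQ0 hvar hQ))
    refine integral_mono (integrable_of_memLp_top hG1).norm
      (integrable_of_memLp_top ((memLp_const 1).sub hT)).norm fun ω => ?_
    simp only [abs_mul]
    exact mul_le_of_le_one_left (abs_nonneg _) (hf _).2.2
  have hJL : ∀ {γ : ℝ}, MemLp (fun ω => steinWeight t ε γ (W ω)) ∞ P :=
    memLp_top_steinWeight hε hWL hWm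
  have hb2 : ∀ k, |∫ ω, X k ω * (η k ω * f' (W ω) - (f (W ω) - f (W ω - η k ω))) ∂P| ≤
      (∫ ω, |X k ω| * η k ω ^ 2 * steinWeight t ε β (W ω) ∂P) / 2 := fun k => by
    rw [← integral_div]
    refine (abs_integral_le_integral_abs).trans ?_
    refine integral_mono_ae (integrable_of_memLp_top (hG2 k)).norm
      ((integrable_of_memLp_top (memLp_top_mul
        (memLp_top_mul (hX.memLp_top k).norm (memLp_top_pow (hηL k) 2)) hJL)).div_const 2) ?_
    filter_upwards [hX.ae_abs_sum_nbhd_le hb] with ω hω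
    have := stein_taylor (t := t) (w := W ω) hε (fun w => (hf w).1) (fun w => (hf w).2.1)
      (fun w => (hf w).2.2) ((hω k).trans hβ)
    rw [abs_mul]
    calc |X k ω| * |η k ω * f' (W ω) - (f (W ω) - f (W ω - η k ω))|
        ≤ |X k ω| * (steinWeight t ε β (W ω) * η k ω ^ 2 / 2) :=
          mul_le_mul_of_nonneg_left this (abs_nonneg _)
      _ = _ := by ring
  -- The weight widens from `β` to `2β` on passing to `W - η k`, and to `3β` on returning to `W`.
  have hb3 := hX.sum_integral_mul_comp_le (J := steinWeight t ε β)
    (J₁ := steinWeight t ε (β + β)) (J₂ := steinWeight t ε (3 * β)) hb hβ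
    (steinWeight_nonneg hε hβ0) (measurable_steinWeight _ _ _) hJL
    (fun k => memLp_top_steinWeight hε (hWL.sub (hηL k)) (hWm.sub (hηm k))) hJL
    (fun w r hr => steinWeight_le_sub hε hr)
    (fun w r hr => by
      have := steinWeight_le_sub (t := t) (ε := ε) (β := β) (γ := β + β) (w := w - r) (r := -r) hε
        (by rwa [abs_neg])
      rwa [sub_neg_eq_add, sub_add_cancel, show β + β + β = 3 * β by ring] at this)
  have hb4 := integral_steinWeight_le (t := t) (ε := ε) (β := 3 * β) hWL hWm hvar
  have hJ0 : 0 ≤ ∫ ω, steinWeight t ε (3 * β) (W ω) ∂P :=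
    integral_nonneg fun ω => steinWeight_nonneg hε (by positivity) _
  have hR0 : 0 ≤ R := le_trans (mul_nonneg (by positivity)
    (Finset.sum_nonneg fun k _ => integral_nonneg fun ω => by positivity)) hR
  rw [hid]
  refine (abs_add_le _ _).trans (add_le_add hb1 ?_)
  calc |∑ k, ∫ ω, X k ω * (η k ω * f' (W ω) - (f (W ω) - f (W ω - η k ω))) ∂P|
      ≤ ∑ k, (∫ ω, |X k ω| * η k ω ^ 2 * steinWeight t ε β (W ω) ∂P) / 2 :=
        (Finset.abs_sum_le_sum_abs _ _).trans (Finset.sum_le_sum fun k _ => hb2 k)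
    _ = (∑ k, ∫ ω, |X k ω| * η k ω ^ 2 * steinWeight t ε β (W ω) ∂P) / 2 := by
        rw [Finset.sum_div]
    _ ≤ (R * ∫ ω, steinWeight t ε (3 * β) (W ω) ∂P) / 2 := by
        gcongr
        exact hb3.trans (by gcongr)
    _ ≤ (R * (2.26 + 3 * β + (P.map W).real (Ioc (t - 3 * β) (t + ε + 3 * β)) / ε)) / 2 := by
        gcongr
    _ = _ := by ring

end IsLocallyDependent

/-! ### Kolmogorov distance: concentration and smoothing -/

lemma abs_measureReal_Iic_sub_le_one (μ ν : Measure ℝ) [IsProbabilityMeasure μ]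
    [IsProbabilityMeasure ν] (s : ℝ) : |μ.real (Iic s) - ν.real (Iic s)| ≤ 1 := by
  have h1 : μ.real (Iic s) ≤ 1 := measureReal_le_one
  have h2 : ν.real (Iic s) ≤ 1 := measureReal_le_one
  have h3 : 0 ≤ μ.real (Iic s) := measureReal_nonneg
  have h4 : 0 ≤ ν.real (Iic s) := measureReal_nonneg
  rw [abs_le]
  constructor <;> linarith

lemma kolmogorovDist_le_one (μ ν : Measure ℝ) [IsProbabilityMeasure μ] [IsProbabilityMeasure ν] :
    kolmogorovDist μ ν ≤ 1 :=
  ciSup_le (abs_measureReal_Iic_sub_le_one μ ν)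

lemma abs_measureReal_sub_le_kolmogorovDist (μ ν : Measure ℝ) [IsProbabilityMeasure μ]
    [IsProbabilityMeasure ν] (t : ℝ) :
    |μ.real (Iic t) - ν.real (Iic t)| ≤ kolmogorovDist μ ν := by
  refine le_ciSup (f := fun t => |μ.real (Iic t) - ν.real (Iic t)|) ⟨1, ?_⟩ t
  rintro _ ⟨s, rfl⟩
  exact abs_measureReal_Iic_sub_le_one μ ν s

lemma measureReal_Ioc_eq (μ : Measure ℝ) [IsProbabilityMeasure μ] {a b : ℝ} (hab : a ≤ b) :
    μ.real (Ioc a b) = μ.real (Iic b) - μ.real (Iic a) := by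
  have e : Ioc a b = Iic b \ Iic a := by
    ext x
    simp [and_comm]
  rw [e, measureReal_sdiff (Iic_subset_Iic.2 hab) measurableSet_Iic]

lemma measureReal_Ioc_le_of_kolmogorovDist (μ : Measure ℝ) [IsProbabilityMeasure μ] {a b : ℝ}
    (hab : a ≤ b) :
    μ.real (Ioc a b) ≤ 0.4 * (b - a) + 2 * kolmogorovDist μ (gaussianReal 0 1) := by
  have h1 := abs_le.1 (abs_measureReal_sub_le_kolmogorovDist μ (gaussianReal 0 1) a)
  have h2 := abs_le.1 (abs_measureReal_sub_le_kolmogorovDist μ (gaussianReal 0 1) b)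
  have h3 := stdGaussian_real_Iic_sub_le hab
  rw [measureReal_Ioc_eq μ hab]
  linarith [h1.1, h2.2]

lemma integrable_ramp (μ : Measure ℝ) [IsProbabilityMeasure μ] (t ε : ℝ) :
    Integrable (ramp t ε) μ :=
  Integrable.of_bound (continuous_ramp t ε).aestronglyMeasurable 1
    (Eventually.of_forall fun x => by
      rw [Real.norm_eq_abs, abs_of_nonneg (ramp_nonneg t ε x)]
      exact ramp_le_one t ε x)

lemma measureReal_Iic_le_integral_ramp (μ : Measure ℝ) [IsProbabilityMeasure μ] {t ε : ℝ}
    (hε : 0 < ε) : μ.real (Iic t) ≤ ∫ x, ramp t ε x ∂μ := by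
  rw [← integral_indicator_one measurableSet_Iic]
  refine integral_mono ((integrable_const 1).indicator measurableSet_Iic)
    (integrable_ramp μ t ε) fun x => ?_
  by_cases hx : x ∈ Iic t
  · rw [indicator_of_mem hx, ramp_of_le hε hx, Pi.one_apply]
  · rw [indicator_of_notMem hx]
    exact ramp_nonneg t ε x

lemma integral_ramp_le_measureReal_Iic (μ : Measure ℝ) [IsProbabilityMeasure μ] {t ε : ℝ}
    (hε : 0 < ε) : ∫ x, ramp t ε x ∂μ ≤ μ.real (Iic (t + ε)) := by
  rw [← integral_indicator_one measurableSet_Iic]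
  refine integral_mono (integrable_ramp μ t ε)
    ((integrable_const 1).indicator measurableSet_Iic) fun x => ?_
  by_cases hx : x ∈ Iic (t + ε)
  · rw [indicator_of_mem hx, Pi.one_apply]
    exact ramp_le_one t ε x
  · rw [indicator_of_notMem hx, ramp_of_ge hε (le_of_lt (not_le.1 hx))]

/-- Smoothing of the Kolmogorov distance by ramp functions. -/
lemma kolmogorovDist_le_of_ramp (μ : Measure ℝ) [IsProbabilityMeasure μ] {ε T : ℝ} (hε : 0 < ε)
    (h : ∀ t, |∫ x, ramp t ε x ∂μ - ∫ x, ramp t ε x ∂gaussianReal 0 1| ≤ T) :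
    kolmogorovDist μ (gaussianReal 0 1) ≤ 0.4 * ε + T := by
  refine ciSup_le fun t => ?_
  have h1 := (abs_le.1 (h t)).2
  have h2 := (abs_le.1 (h (t - ε))).1
  have h3 := measureReal_Iic_le_integral_ramp μ (t := t) hε
  have h4 := integral_ramp_le_measureReal_Iic μ (t := t - ε) hε
  have h5 := measureReal_Iic_le_integral_ramp (gaussianReal 0 1) (t := t - ε) hε
  have h6 := integral_ramp_le_measureReal_Iic (gaussianReal 0 1) (t := t) hε
  have h7 := stdGaussian_real_Iic_sub_le (show t ≤ t + ε by linarith)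
  have h8 := stdGaussian_real_Iic_sub_le (show t - ε ≤ t by linarith)
  rw [sub_add_cancel] at h4
  rw [abs_le]
  constructor <;> linarith

/-- A Berry–Esseen bound for bounded locally dependent random variables. -/
theorem IsLocallyDependent.kolmogorovDist_le {V Ω : Type*} [Fintype V] [MeasurableSpace Ω]
    {P : Measure Ω} [IsProbabilityMeasure P] {X : V → Ω → ℝ} {N : V → Finset V} {m : ℕ} {b : ℝ}
    (hX : IsLocallyDependent X N m b P) {β R Q : ℝ} (hb : 0 ≤ b) (hβ : m * b ≤ β)
    (hvar : ∫ ω, (∑ k, X k ω) ^ 2 ∂P = 1) (hR0 : 0 < R)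
    (hR : (m : ℝ) ^ 2 * ∑ k, ∫ ω, |X k ω| ^ 3 ∂P ≤ R) (hQ0 : 0 ≤ Q)
    (hQ : (m : ℝ) ^ 3 * ∑ k, ∫ ω, X k ω ^ 4 ∂P ≤ Q ^ 2) :
    kolmogorovDist (P.map fun ω => ∑ k, X k ω) (gaussianReal 0 1) ≤
      1.5 * ((1.4 + (2.26 + 3 * β) / 2) * R + 2 * Q + 0.4 * β) := by
  have hWm : Measurable fun ω => ∑ k, X k ω := hX.measurable_sum Finset.univ
  have : IsProbabilityMeasure (P.map fun ω => ∑ k, X k ω) :=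
    Measure.isProbabilityMeasure_map hWm.aemeasurable
  set μ := P.map fun ω => ∑ k, X k ω
  set Δ := kolmogorovDist μ (gaussianReal 0 1)
  have hβ0 : 0 ≤ β := le_trans (by positivity) hβ
  -- With `ε = 3R`, the term `R / 2 * (2 * Δ / ε)` is `Δ / 3`; moving it to the left yields the
  -- factor `1.5`.
  have hε : 0 < 3 * R := by positivity
  have key : Δ ≤ 0.4 * (3 * R) + (2 * Q + R / 2 * (2.26 + 3 * β +
      (0.4 * (3 * R + 6 * β) + 2 * Δ) / (3 * R))) := by
    refine kolmogorovDist_le_of_ramp μ hε fun t => ?_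
    have h1 := hX.abs_integral_ramp_sub_le (t := t) hb hβ hvar hR hQ0 hQ hε
    have h2 := measureReal_Ioc_le_of_kolmogorovDist μ
      (show t - 3 * β ≤ t + 3 * R + 3 * β by linarith)
    rw [integral_map hWm.aemeasurable (continuous_ramp _ _).aestronglyMeasurable]
    refine h1.trans ?_
    gcongr
    calc μ.real (Ioc (t - 3 * β) (t + 3 * R + 3 * β)) ≤ _ := h2
      _ = _ := by ring
  have e : R / 2 * (2.26 + 3 * β + (0.4 * (3 * R + 6 * β) + 2 * Δ) / (3 * R)) =
      R / 2 * (2.26 + 3 * β) + (0.4 * (3 * R + 6 * β) + 2 * Δ) / 6 := by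
    field_simp
    ring
  rw [e] at key
  linarith

/-! ### From dependency graphs to local dependence -/

section Graph

variable {V E Ω : Type*}

/-- Choose an edge to each neighbour; an edge and one of its ends determine the other end, so the
choice is injective. -/
lemma encard_neighbors_le (G : Graph V E) (k : V) :
    {j | G.Adj k j}.encard ≤ (G.incidenceSet k).encard := by
  have h : ∀ j : {j | G.Adj k j}, ∃ e, G.IsLink e k j := fun j => j.2
  choose e he using h
  refine Function.Embedding.encard_le ⟨fun j => ⟨e j, (he j).inc_left⟩, fun i j hij => ?_⟩
  have h1 := he i
  rw [Subtype.mk.inj hij] at h1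
  exact Subtype.ext (h1.right_unique (he j))

variable [Fintype V]

open scoped Classical in
/-- The closed neighbourhood of a vertex of a multigraph. -/
noncomputable def closedNbhd (G : Graph V E) (k : V) : Finset V :=
  {j | j = k ∨ G.Adj k j}

lemma mem_closedNbhd {G : Graph V E} {k j : V} : j ∈ closedNbhd G k ↔ j = k ∨ G.Adj k j := by
  simp [closedNbhd]

lemma card_closedNbhd_le {G : Graph V E} {D : ℕ} (hD : maxDegree G = (D : ℕ∞)) (k : V) :
    (closedNbhd G k).card ≤ D + 1 := by
  have h1 : (closedNbhd G k : Set V) = insert k {j | G.Adj k j} := by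
    ext j
    simp [mem_closedNbhd]
  have h2 : ((closedNbhd G k : Set V)).encard ≤ (D : ℕ∞) + 1 := by
    rw [h1]
    refine (encard_insert_le _ _).trans ?_
    gcongr
    refine (encard_neighbors_le G k).trans ?_
    rw [← hD]
    exact le_iSup (fun k => (G.incidenceSet k).encard) k
  rw [encard_coe_eq_coe_finsetCard] at h2
  exact_mod_cast h2

variable [MeasurableSpace Ω] {P : Measure Ω}

/-- Apply the graph condition to `{k}` and the complement of its closed neighbourhood. The maps `g
k` allow `X` to be the normalised `Y`. -/
lemma IsDependencyGraph.indepFun_sum_compl {G : Graph V E} {Y : V → Ω → ℝ}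
    (hG : IsDependencyGraph G Y P) {X : V → Ω → ℝ} {g : V → ℝ → ℝ} (hg : ∀ k, Measurable (g k))
    (hX : ∀ k ω, X k ω = g k (Y k ω)) (k : V) :
    IndepFun (X k) (fun ω => ∑ j, X j ω - ∑ j ∈ closedNbhd G k, X j ω) P := by
  classical
  have h := hG.2 {k} {j | j ∉ closedNbhd G k}
    (by simp [mem_closedNbhd])
    (by
      rintro i rfl j hj hij
      exact hj (mem_closedNbhd.2 (Or.inr hij)))
  have h1 : Measurable fun y : ({k} : Set V) → ℝ => g k (y ⟨k, rfl⟩) :=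
    (hg k).comp (measurable_pi_apply _)
  have h2 : Measurable fun y : ({j | j ∉ closedNbhd G k} : Set V) → ℝ => 
      ∑ j : ({j | j ∉ closedNbhd G k} : Set V), g j (y j) :=
    Finset.measurable_fun_sum _ fun j _ => (hg j).comp (measurable_pi_apply _)
  have h3 := h.comp h1 h2
  have e1 : X k = (fun y : ({k} : Set V) → ℝ => g k (y ⟨k, rfl⟩)) ∘ fun ω k => Y k ω := by
    ext ω
    simp [hX]
  have e2 : (fun ω => ∑ j, X j ω - ∑ j ∈ closedNbhd G k, X j ω) =
      (fun y : ({j | j ∉ closedNbhd G k} : Set V) → ℝ => 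
      ∑ j : ({j | j ∉ closedNbhd G k} : Set V), g j (y j)) ∘ fun ω k => Y k ω := by
    ext ω
    rw [← Finset.sum_compl_add_sum (closedNbhd G k), add_sub_cancel_right]
    simp only [hX, Function.comp_apply]
    exact Finset.sum_subtype _ (by simp) fun j => g j (Y j ω)
  rw [e1, e2]
  exact h3

lemma IsDependencyGraph.indepFun_mul_mul {G : Graph V E} {Y : V → Ω → ℝ}
    (hG : IsDependencyGraph G Y P) {X : V → Ω → ℝ} {g : V → ℝ → ℝ} (hg : ∀ k, Measurable (g k))
    (hX : ∀ k ω, X k ω = g k (Y k ω)) {k j l n : V} (hlk : l ∉ closedNbhd G k)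
    (hlj : l ∉ closedNbhd G j) (hnk : n ∉ closedNbhd G k) (hnj : n ∉ closedNbhd G j) :
    IndepFun (fun ω => X k ω * X j ω) (fun ω => X l ω * X n ω) P := by
  simp only [mem_closedNbhd, not_or] at hlk hlj hnk hnj
  have h := hG.2 {k, j} {l, n}
    (by
      simp only [disjoint_insert_left, disjoint_singleton_left, mem_insert_iff, mem_singleton_iff,
        not_or]
      exact ⟨⟨Ne.symm hlk.1, Ne.symm hnk.1⟩, Ne.symm hlj.1, Ne.symm hnj.1⟩)
    (by
      rintro a (rfl | rfl) b (rfl | rfl)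
      exacts [hlk.2, hnk.2, hlj.2, hnj.2])
  have hm : ∀ a b : V, Measurable fun y : ({a, b} : Set V) → ℝ =>
      g a (y ⟨a, by simp⟩) * g b (y ⟨b, by simp⟩) := fun a b =>
    ((hg a).comp (measurable_pi_apply _)).mul ((hg b).comp (measurable_pi_apply _))
  have h3 := h.comp (hm k j) (hm l n)
  simp only [Function.comp_def] at h3
  simpa only [hX] using h3

end Graph

/-! ### Moments after centring -/

section Moments

variable {Ω : Type*} [MeasurableSpace Ω] {P : Measure Ω} [IsProbabilityMeasure P]

/-- Jensen through the tangent of the cube at `a = E|Z|`: `z³ - 3a²z + 2a³ = (z + 2a)(z - a)² ≥ 0`.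
-/
lemma abs_integral_pow_three_le {Z : Ω → ℝ} (hZ : MemLp Z ∞ P) :
    |∫ ω, Z ω ∂P| ^ 3 ≤ ∫ ω, |Z ω| ^ 3 ∂P := by
  have h1 : Integrable (fun ω => |Z ω|) P := (hZ.integrable le_top).norm
  have h3 : Integrable (fun ω => |Z ω| ^ 3) P :=
    (IsLocallyDependent.memLp_top_pow hZ.norm 3).integrable le_top
  set a := ∫ ω, |Z ω| ∂P
  have ha : 0 ≤ a := integral_nonneg fun ω => abs_nonneg _
  calc |∫ ω, Z ω ∂P| ^ 3 ≤ a ^ 3 := by gcongr; exact abs_integral_le_integral_abs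
    _ = ∫ ω, (3 * a ^ 2 * |Z ω| - 2 * a ^ 3) ∂P := by
      rw [integral_sub (h1.const_mul _) (integrable_const _), integral_const_mul]
      simp only [integral_const, probReal_univ, one_smul]
      ring
    _ ≤ _ := by
      refine integral_mono ((h1.const_mul _).sub (integrable_const _)) h3 fun ω => ?_
      simp only
      have h0 := abs_nonneg (Z ω)
      nlinarith [mul_nonneg (add_nonneg h0 (add_nonneg ha ha)) (sq_nonneg (|Z ω| - a))]

lemma integral_abs_sub_integral_pow_three_le {Z : Ω → ℝ} (hZ : MemLp Z ∞ P) :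
    ∫ ω, |Z ω - ∫ ω', Z ω' ∂P| ^ 3 ∂P ≤ 8 * ∫ ω, |Z ω| ^ 3 ∂P := by
  have h3 : Integrable (fun ω => |Z ω| ^ 3) P :=
    (IsLocallyDependent.memLp_top_pow hZ.norm 3).integrable le_top
  have h := abs_integral_pow_three_le hZ
  set a := ∫ ω, Z ω ∂P
  have hi : Integrable (fun ω => |Z ω - a| ^ 3) P :=
    (IsLocallyDependent.memLp_top_pow (hZ.sub (memLp_const a)).norm 3).integrable le_top
  calc ∫ ω, |Z ω - a| ^ 3 ∂P ≤ ∫ ω, (4 * |Z ω| ^ 3 + 4 * |a| ^ 3) ∂P := by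
        refine integral_mono hi ((h3.const_mul 4).add (integrable_const _)) fun ω => ?_
        simp only
        have h0 := abs_nonneg (Z ω)
        have h1 := abs_nonneg a
        calc |Z ω - a| ^ 3 ≤ (|Z ω| + |a|) ^ 3 := by gcongr; exact abs_sub _ _
          _ ≤ _ := by nlinarith [mul_nonneg (add_nonneg h0 h1) (sq_nonneg (|Z ω| - |a|))]
    _ = 4 * (∫ ω, |Z ω| ^ 3 ∂P) + 4 * |a| ^ 3 := by
        rw [integral_add (h3.const_mul 4) (integrable_const _), integral_const_mul]
        simp
    _ ≤ _ := by linarith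

lemma integral_pow_four_le {U : Ω → ℝ} (hU : MemLp U ∞ P) {b : ℝ} (hb : ∀ᵐ ω ∂P, |U ω| ≤ b) :
    ∫ ω, U ω ^ 4 ∂P ≤ b * ∫ ω, |U ω| ^ 3 ∂P := by
  rw [← integral_const_mul]
  refine integral_mono_ae ((IsLocallyDependent.memLp_top_pow hU 4).integrable le_top)
    (((IsLocallyDependent.memLp_top_pow hU.norm 3).integrable le_top).const_mul b) ?_
  filter_upwards [hb] with ω hω
  calc U ω ^ 4 = |U ω| * |U ω| ^ 3 := by
        rw [← pow_succ', ← abs_pow, abs_of_nonneg (show 0 ≤ U ω ^ 4 by positivity)]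
    _ ≤ b * |U ω| ^ 3 := by gcongr

lemma ae_abs_sub_integral_le {Z : Ω → ℝ} {L : ℝ} (hZ : ∀ᵐ ω ∂P, |Z ω| ≤ L) :
    ∀ᵐ ω ∂P, |Z ω - ∫ ω', Z ω' ∂P| ≤ 2 * L := by
  have h : |∫ ω, Z ω ∂P| ≤ L := by
    have := norm_integral_le_of_norm_le_const (μ := P) (f := Z) hZ
    rwa [probReal_univ, mul_one] at this
  filter_upwards [hZ] with ω hω
  calc |Z ω - ∫ ω', Z ω' ∂P| ≤ |Z ω| + |∫ ω', Z ω' ∂P| := abs_sub _ _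
    _ ≤ 2 * L := by linarith

end Moments

end DepGraph

/-! ### The main theorem -/

open DepGraph in
theorem mainTheorem1 {V E Ω : Type*} [Fintype V] [MeasurableSpace Ω]
    (P : Measure Ω) [IsProbabilityMeasure P]
    (Y : V → Ω → ℝ) (hY : ∀ k, Measurable (Y k))
    (G : Graph V E) (hG : DepGraph.IsDependencyGraph G Y P)
    (D : ℕ) (hD : DepGraph.maxDegree G = (D : ℕ∞))
    (c : V → ℝ) (L : ℝ) (hL : 0 < L)
    (hYL : ∀ k, eLpNorm (fun ω => Y k ω - c k) ∞ P ≤ ENNReal.ofReal L)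
    (hv : 0 < DepGraph.stdDev Y P) :
    DepGraph.kolmogorovDist (P.map (DepGraph.normalizedSum Y P)) (gaussianReal 0 1) ≤
      max (68.5 * (((D : ℝ) + 1) ^ 2 * DepGraph.absMoment Y c P 3 / DepGraph.stdDev Y P ^ 3))
        (22.88 * (L * ((D : ℝ) + 1) / DepGraph.stdDev Y P)) := by
  set v := stdDev Y P with hvdef
  set A₃ := absMoment Y c P 3 with hA₃def
  set B := max (68.5 * (((D : ℝ) + 1) ^ 2 * A₃ / v ^ 3)) (22.88 * (L * ((D : ℝ) + 1) / v))
  set X : V → Ω → ℝ := fun k ω => (Y k ω - ∫ ω', Y k ω' ∂P) / v with hXdef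
  have hZ : ∀ k, ∀ᵐ ω ∂P, |Y k ω - c k| ≤ L := fun k => by
    have h := hYL k
    rw [eLpNorm_exponent_top] at h
    filter_upwards [enorm_ae_le_eLpNormEssSup (fun ω => Y k ω - c k) P] with ω hω
    have h1 := hω.trans h
    rwa [Real.enorm_eq_ofReal_abs, ENNReal.ofReal_le_ofReal_iff hL.le] at h1
  have hZL : ∀ k, MemLp (fun ω => Y k ω - c k) ∞ P := fun k =>
    memLp_top_of_bound ((hY k).sub_const _).aestronglyMeasurable L (hZ k)
  have hYi : ∀ k, Integrable (Y k) P := fun k => by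
    have h := ((hZL k).integrable le_top).add (integrable_const (c k))
    exact h.congr (Filter.Eventually.of_forall fun ω => sub_add_cancel _ _)
  -- Centring `Y k` or `Y k - c k` gives the same variable, so bounds on `Y k - c k` pass to `X k`
  -- at the cost of factors `2` (sup norm) and `8` (third moment).
  have hcen : ∀ k ω, Y k ω - ∫ ω', Y k ω' ∂P =
      (Y k ω - c k) - ∫ ω', (Y k ω' - c k) ∂P := fun k ω => by
    rw [integral_sub (hYi k) (integrable_const _)]
    simp
  have hXm : ∀ k, Measurable (X k) := fun k => ((hY k).sub_const _).div_const _
  have hXb : ∀ k, ∀ᵐ ω ∂P, |X k ω| ≤ 2 * L / v := fun k => by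
    filter_upwards [ae_abs_sub_integral_le (hZ k)] with ω hω
    rw [abs_div, abs_of_pos hv, hcen]
    gcongr
  have hgm : ∀ k, Measurable fun y : ℝ => (y - ∫ ω', Y k ω' ∂P) / v := fun k => by fun_prop
  have hX : IsLocallyDependent X (closedNbhd G) (D + 1) (2 * L / v) P :=
    { measurable := hXm
      bound := hXb
      integral_eq_zero := fun k => by
        simp only [hXdef]
        rw [integral_div, integral_sub (hYi k) (integrable_const _)]
        simp
      symm := fun {i j} h => by
        rw [mem_closedNbhd] at h ⊢
        exact h.imp Eq.symm Graph.Adj.symm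
      card_le := card_closedNbhd_le hD
      indep := hG.indepFun_sum_compl hgm fun _ _ => rfl
      indep_pair := hG.indepFun_mul_mul hgm fun _ _ => rfl }
  have hW : normalizedSum Y P = fun ω => ∑ k, X k ω := by
    ext ω
    simp only [normalizedSum, sumS, hXdef]
    rw [integral_finsetSum _ fun k _ => hYi k, ← Finset.sum_sub_distrib, Finset.sum_div]
  have hSm : Measurable (sumS Y) := Finset.measurable_fun_sum _ fun k _ => hY k
  have hvar : ∫ ω, (∑ k, X k ω) ^ 2 ∂P = 1 := by
    have h1 : ∀ ω, (∑ k, X k ω) ^ 2 = (sumS Y ω - ∫ ω', sumS Y ω' ∂P) ^ 2 / v ^ 2 := fun ω => by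
      rw [← congrFun hW ω, normalizedSum, div_pow]
    simp_rw [h1]
    rw [integral_div, ← variance_eq_integral hSm.aemeasurable, hvdef, stdDev,
      Real.sq_sqrt (variance_nonneg _ _), div_self]
    exact (Real.sqrt_pos.1 hv).ne'
  have hA₃ : A₃ = ∑ k, ∫ ω, |Y k ω - c k| ^ 3 ∂P := by
    simp only [hA₃def, absMoment, Real.rpow_ofNat]
  have hA₃0 : 0 ≤ A₃ := by
    rw [hA₃]
    exact Finset.sum_nonneg fun k _ => integral_nonneg fun ω => by positivity
  have hX3 : ∑ k, ∫ ω, |X k ω| ^ 3 ∂P ≤ 8 * A₃ / v ^ 3 := by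
    rw [hA₃, Finset.mul_sum, Finset.sum_div]
    refine Finset.sum_le_sum fun k _ => ?_
    simp only [hXdef, abs_div, div_pow, abs_of_pos hv]
    rw [integral_div]
    gcongr
    simp_rw [hcen k]
    exact integral_abs_sub_integral_pow_three_le (hZL k)
  have hX4 : ∑ k, ∫ ω, X k ω ^ 4 ∂P ≤ 2 * L / v * (8 * A₃ / v ^ 3) := by
    calc ∑ k, ∫ ω, X k ω ^ 4 ∂P ≤ ∑ k, 2 * L / v * ∫ ω, |X k ω| ^ 3 ∂P :=
          Finset.sum_le_sum fun k _ => integral_pow_four_le (hX.memLp_top k) (hXb k)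
      _ ≤ _ := by
          rw [← Finset.mul_sum]
          gcongr
  have hprob : IsProbabilityMeasure (P.map (normalizedSum Y P)) := by
    rw [hW]
    exact Measure.isProbabilityMeasure_map (hX.measurable_sum Finset.univ).aemeasurable
  rcases le_total 1 B with hB1 | hB1
  · exact (kolmogorovDist_le_one _ _).trans hB1
  set x := L * ((D : ℝ) + 1) / v with hx
  set y := ((D : ℝ) + 1) ^ 2 * A₃ / v ^ 3 with hy
  have hx0 : 0 < x := by positivity
  have hy0 : 0 ≤ y := by positivity
  have hxB : 22.88 * x ≤ B := le_max_right _ _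
  have hyB : 68.5 * y ≤ B := le_max_left _ _
  have hB0 : 0 < B := lt_of_lt_of_le (by positivity) hxB
  have hxyB : (22.88 * x) * (68.5 * y) ≤ B * B := by gcongr
  -- `β` and `R` bound `2x` and `8y`; using `B` instead keeps `R` positive even if `y = 0`. The
  -- fourth-moment term is at most `16xy ≤ 16 B² / (22.88 * 68.5)`, and `0.10105` slightly exceeds
  -- the square root of that coefficient.
  have hmain := hX.kolmogorovDist_le (β := 2 * B / 22.88) (R := 8 * B / 68.5) (Q := 0.10105 * B)
    (by positivity)
    (by
      push_cast
      calc ((D : ℝ) + 1) * (2 * L / v) = 2 * x := by rw [hx]; ring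
        _ ≤ 2 * B / 22.88 := by rw [le_div_iff₀ (by norm_num)]; linarith)
    hvar (by positivity)
    (by
      push_cast
      calc ((D : ℝ) + 1) ^ 2 * ∑ k, ∫ ω, |X k ω| ^ 3 ∂P
          ≤ ((D : ℝ) + 1) ^ 2 * (8 * A₃ / v ^ 3) := by gcongr
        _ = 8 * y := by rw [hy]; ring
        _ ≤ 8 * B / 68.5 := by rw [le_div_iff₀ (by norm_num)]; linarith)
    (by positivity)
    (by
      push_cast
      calc ((D : ℝ) + 1) ^ 3 * ∑ k, ∫ ω, X k ω ^ 4 ∂P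
          ≤ ((D : ℝ) + 1) ^ 3 * (2 * L / v * (8 * A₃ / v ^ 3)) := by gcongr
        _ = 16 * (x * y) := by rw [hx, hy]; field_simp; ring
        _ ≤ (0.10105 * B) ^ 2 := by nlinarith)
  rw [hW]
  refine hmain.trans ?_
  clear_value B
  -- The product `β * R` is quadratic in `B`; `B ≤ 1` makes it linear.
  have hBB : B * B ≤ B := mul_le_of_le_one_left hB0.le hB1
  norm_num at hBB ⊢
  linarith
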